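/- Let $\Gamma$ be a discrete group with neutral element $e$, and let $\omega\colon\Gamma\times\Gamma\to \mathrm U(1)$ be a normalised $2$-cocycle: $\omega(g,h)\,\omega(gh,k)=\omega(h,k)\,\omega(g,hk)$ and $\omega(g,e)=\omega(e,g)=1$. Let $\overline\omega$ be the complex conjugate cocycle. Define unitaries on $\ell^2(\Gamma)$ by $\lambda^{(\omega)}_g\delta_h=\omega(g,h)\,\delta_{gh}$, let $C^*_{r,\omega}(\Gamma)\subset B(\ell^2(\Gamma))$ be the $C^*$-algebra generated by the $\lambda^{(\omega)}_g$, and write $\lambda_g$ and $C^*_r(\Gamma)$ for trivial $\omega$. All tensor products of $C^*$-algebras are minimal, $\iota$ is the identity map, subscripts denote the legs of a tensor product, and $\delta_h$ in an operator formula denotes the projection of $\ell^2(\Gamma)$ onto the line spanned by the basis vector $\delta_h$. Let $\delta\colon C^*_r(\Gamma)\to C^*_r(\Gamma)\otimes C^*_r(\Gamma)$ and $\delta^{(\omega)}_l\colon C^*_{r,\omega}(\Gamma)\to C^*_r(\Gamma)\otimes C^*_{r,\omega}(\Gamma)$ be the $*$-homomorphisms with $\delta(\lambda_g)=\lambda_g\otimes\lambda_g$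 and $\delta_l^{(\omega)}(\lambda^{(\omega)}_g)=\lambda_g\otimes\lambda^{(\omega)}_g$, and put $$\widetilde{\mathrm{Ad}}^{(\omega)}(x)=\sum_{h\in\Gamma}\delta_h\otimes \lambda^{(\omega)}_{h^{-1}}\,x\,(\lambda^{(\omega)}_{h^{-1}})^*\qquad(x\in C^*_{r,\omega}(\Gamma)).$$ Let $A$ be a $C^*$-algebra with a continuous coaction of $C^*_r(\Gamma)$, that is, a $*$-homomorphism $\alpha\colon A\to C^*_r(\Gamma)\otimes A$ such that $(\iota\otimes\alpha)\alpha=(\delta\otimes\iota)\alpha$ and the linear span of $(C^*_r(\Gamma)\otimes1)\,\alpha(A)$ is dense in $C^*_r(\Gamma)\otimes A$. Represent $A$ faithfully on a Hilbert space $H$ (any faithful representation may be taken). The braided tensor product $A\boxtimes C^*_{r,\overline\omega}(\Gamma)$ is the $C^*$-algebra of operators on $\ell^2(\Gamma)\otimes H\otimes\ell^2(\Gamma)$ generated by the operators $\alpha(a)_{12}\,\widetilde{\mathrm{Ad}}^{(\overline\omega)}(x)_{13}$ with $a\in A$ and $x\in C^*_{r,\overline\omega}(\Gamma)$. Its diagonal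 coaction is the $*$-homomorphism $\alpha\otimes\delta_l^{(\overline\omega)}$ into the bounded operators on $\ell^2(\Gamma)\otimes\ell^2(\Gamma)\otimes H\otimes\ell^2(\Gamma)$ determined by $$\alpha(a)_{12}\,\widetilde{\mathrm{Ad}}^{(\overline\omega)}(x)_{13}\;\longmapsto\;(\delta\otimes\iota)(\alpha(a))_{123}\;\bigl(\iota\otimes\widetilde{\mathrm{Ad}}^{(\overline\omega)}\bigr)\bigl(\delta^{(\overline\omega)}_l(x)\bigr)_{124}.$$ The $\omega$-deformation of $A$ is the fixed point algebra $$A_\omega=\bigl\{T\in A\boxtimes C^*_{r,\overline\omega}(\Gamma)\;:\;(\alpha\otimes\delta^{(\overline\omega)}_l)(T)=1\otimes T\bigr\}.$$ Then $A_\omega$ is $*$-isomorphic to the subalgebra $$A'_\omega=\bigl\{x\in C^*_{r,\omega}(\Gamma)\otimes A\;:\;(\iota\otimes\alpha)(x)_{213}=(\delta^{(\omega)}_l\otimes\iota)(x)\bigr\}$$ of $C^*_{r,\omega}(\Gamma)\otimes A$. -/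

import Mathlib

noncomputable section

namespace CocycleDeformation

open scoped ComplexConjugate InnerProductSpace

/-- The Hilbert space `ℓ²(I) ⊗ H`, realised as the space of square summable `H`-valued functions
on `I`; `δ_i ⊗ ξ` is the function supported at `i` with value `ξ`. -/
abbrev L2 (I : Type*) (H : Type*) [NormedAddCommGroup H] : Type _ := lp (fun _ : I => H) 2

section Spaces

variable {I J I' J' H K : Type*}
  [NormedAddCommGroup H] [NormedAddCommGroup K]

theorem memℓp_two_iff {f : I → H} : Memℓp f 2 ↔ Summable fun i => ‖f i‖ ^ 2 := by
  rw [memℓp_gen_iff (by norm_num)]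
  simp

theorem L2.summable_sq (f : L2 I H) : Summable fun i => ‖f i‖ ^ 2 :=
  memℓp_two_iff.1 (lp.memℓp f)

theorem L2.norm_sq (f : L2 I H) : ‖f‖ ^ 2 = ∑' i, ‖f i‖ ^ 2 := by
  have := lp.norm_rpow_eq_tsum (p := 2) (by norm_num) f
  simpa using this

theorem L2.norm_eq_of_tsum {f : L2 I H} {g : L2 J K} (h : ∑' i, ‖f i‖ ^ 2 = ∑' j, ‖g j‖ ^ 2) :
    ‖f‖ = ‖g‖ := by
  rw [← sq_eq_sq₀ (norm_nonneg _) (norm_nonneg _), L2.norm_sq, L2.norm_sq, h]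

variable [InnerProductSpace ℂ H] [InnerProductSpace ℂ K]

/-- The identification `ℓ²(J) ⊗ H = ℓ²(I) ⊗ H` coming from a bijection `I ≃ J`. -/
def reindex (e : I ≃ J) : L2 J H ≃ₗᵢ[ℂ] L2 I H where
  toFun f := ⟨fun i => f (e i), memℓp_two_iff.2 ((e.summable_iff).2 f.summable_sq)⟩
  invFun f := ⟨fun j => f (e.symm j), memℓp_two_iff.2 ((e.symm.summable_iff).2 f.summable_sq)⟩
  left_inv f := by ext j; simp
  right_inv f := by ext j; simp
  map_add' f g := by ext j; rfl
  map_smul' c f := by ext j; rfl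
  norm_map' f := L2.norm_eq_of_tsum (e.tsum_eq (fun j => ‖f j‖ ^ 2))

/-- The identification `ℓ²(I) ⊗ (ℓ²(J) ⊗ H) = ℓ²(I × J) ⊗ H`. -/
def uncurry : L2 I (L2 J H) ≃ₗᵢ[ℂ] L2 (I × J) H where
  toFun f := ⟨fun p => f p.1 p.2, memℓp_two_iff.2 <|
    (summable_prod_of_nonneg (fun p => by positivity)).2
      ⟨fun i => (f i).summable_sq, by simpa only [← L2.norm_sq] using f.summable_sq⟩⟩
  invFun f := ⟨fun i => ⟨fun j => f (i, j), memℓp_two_iff.2 <|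
      ((summable_prod_of_nonneg (fun p => by positivity)).1 f.summable_sq).1 i⟩,
    memℓp_two_iff.2 <| by
      simpa only [L2.norm_sq] using
        ((summable_prod_of_nonneg (fun p => by positivity)).1 f.summable_sq).2⟩
  left_inv f := by ext i j; rfl
  right_inv f := by ext p; rfl
  map_add' f g := by ext p; rfl
  map_smul' c f := by ext p; rfl
  norm_map' f := by
    refine L2.norm_eq_of_tsum ?_
    have hs : Summable fun p : I × J => ‖f p.1 p.2‖ ^ 2 :=
      (summable_prod_of_nonneg (fun p => by positivity)).2
        ⟨fun i => (f i).summable_sq, by simpa only [← L2.norm_sq] using f.summable_sq⟩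
    change ∑' p : I × J, ‖f p.1 p.2‖ ^ 2 = _
    rw [hs.tsum_prod]
    simp only [L2.norm_sq]

/-- For a bijection `e : I × J ≃ I' × J'`, the unitary between `ℓ²(I') ⊗ ℓ²(J') ⊗ H` and
`ℓ²(I) ⊗ ℓ²(J) ⊗ H` given by `(f ∘ e)`. -/
def permute (e : I × J ≃ I' × J') : L2 I' (L2 J' H) ≃ₗᵢ[ℂ] L2 I (L2 J H) :=
  (uncurry.trans (reindex e)).trans uncurry.symm

@[simp] theorem permute_apply (e : I × J ≃ I' × J') (f : L2 I' (L2 J' H)) (i : I) (j : J) :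
    permute e f i j = f (e (i, j)).1 (e (i, j)).2 := rfl

/-- The flip `ℓ²(I) ⊗ ℓ²(J) ⊗ H → ℓ²(J) ⊗ ℓ²(I) ⊗ H`. -/
def flip : L2 I (L2 J H) ≃ₗᵢ[ℂ] L2 J (L2 I H) := permute (Equiv.prodComm J I)

@[simp] theorem flip_apply (f : L2 I (L2 J H)) (i : I) (j : J) : flip f j i = f i j := rfl

/-- The unitary `1 ⊗ e` from `ℓ²(I) ⊗ H` to `ℓ²(I) ⊗ K`. -/
def mapRight (e : H ≃ₗᵢ[ℂ] K) : L2 I H ≃ₗᵢ[ℂ] L2 I K where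
  toFun f := ⟨fun i => e (f i), memℓp_two_iff.2 (by simpa using f.summable_sq)⟩
  invFun f := ⟨fun i => e.symm (f i), memℓp_two_iff.2 (by simpa using f.summable_sq)⟩
  left_inv f := by ext i; simp
  right_inv f := by ext i; simp
  map_add' f g := by ext i; exact map_add e (f i) (g i)
  map_smul' c f := by ext i; exact map_smul e c (f i)
  norm_map' f := L2.norm_eq_of_tsum (by simp)

@[simp] theorem mapRight_apply (e : H ≃ₗᵢ[ℂ] K) (f : L2 I H) (i : I) :
    mapRight e f i = e (f i) := rfl

open scoped Classical in
/-- The isometry `ξ ↦ δ_i ⊗ ξ`. -/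
def single (i : I) : H →L[ℂ] L2 I H := lp.singleContinuousLinearMap ℂ (fun _ : I => H) 2 i

/-- The coordinate map `f ↦ f i`, the adjoint of `ξ ↦ δ_i ⊗ ξ`. -/
def coord (i : I) : L2 I H →L[ℂ] H := lp.evalCLM ℂ (fun _ : I => H) 2 i

@[simp] theorem coord_apply (i : I) (f : L2 I H) : coord i f = f i := rfl

open scoped Classical in
theorem single_apply (i j : I) (x : H) : (single i x : L2 I H) j = if j = i then x else 0 := by
  simp [single, lp.single_apply, Pi.single_apply]

@[simp] theorem single_apply_self (i : I) (x : H) : (single i x : L2 I H) i = x := by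
  simp [single_apply]

theorem single_apply_ne {i j : I} (h : j ≠ i) (x : H) : (single i x : L2 I H) j = 0 := by
  simp [single_apply, h]

theorem norm_single_apply (i : I) (x : H) : ‖(single i x : L2 I H)‖ = ‖x‖ := by
  classical
  simp [single]

theorem inner_single_left (i : I) (x : H) (f : L2 I H) : ⟪(single i x : L2 I H), f⟫_ℂ = ⟪x, f i⟫_ℂ := by
  classical
  exact lp.inner_single_left (𝕜 := ℂ) (G := fun _ : I => H) i x f

theorem inner_single_right (i : I) (x : H) (f : L2 I H) : ⟪f, (single i x : L2 I H)⟫_ℂ = ⟪f i, x⟫_ℂ := by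
  classical
  exact lp.inner_single_right (𝕜 := ℂ) (G := fun _ : I => H) i x f

theorem hasSum_single (f : L2 I H) : HasSum (fun i => (single i (f i) : L2 I H)) f := by
  classical
  exact lp.hasSum_single (by norm_num) f

/-- The matrix coefficient `(i, j)` of an operator on `ℓ²(I) ⊗ H`; it is the value of the slice
map `⟨δ_i, · δ_j⟩ ⊗ ι`. -/
def entry (T : L2 I H →L[ℂ] L2 I H) (i j : I) : H →L[ℂ] H := coord i ∘L T ∘L single j

@[simp] theorem entry_apply (T : L2 I H →L[ℂ] L2 I H) (i j : I) (x : H) :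
    entry T i j x = T (single j x) i := rfl

theorem entry_ext {S T : L2 I H →L[ℂ] L2 I H} (h : ∀ i j, entry S i j = entry T i j) : S = T := by
  ext f : 1
  have h1 := (hasSum_single f).mapL S
  have h2 := (hasSum_single f).mapL T
  refine h1.unique ?_
  convert h2 using 2 with j
  ext i
  exact DFunLike.congr_fun (h i j) (f j)

theorem hasSum_entry_mul (S T : L2 I H →L[ℂ] L2 I H) (i j : I) (x : H) :
    HasSum (fun k => entry S i k (entry T k j x)) (entry (S * T) i j x) := by
  simpa using ((hasSum_single (T (single j x))).mapL (coord i ∘L S))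

variable [CompleteSpace H]

theorem entry_star (T : L2 I H →L[ℂ] L2 I H) (i j : I) :
    entry (star T) i j = star (entry T j i) := by
  rw [ContinuousLinearMap.star_eq_adjoint, ContinuousLinearMap.star_eq_adjoint,
    ContinuousLinearMap.eq_adjoint_iff]
  intro x y
  simp only [entry_apply]
  rw [← inner_single_right, ContinuousLinearMap.adjoint_inner_left, inner_single_left]

end Spaces

section Amplification

theorem bddAbove_const {I E : Type*} [Norm E] (b : E) : BddAbove (Set.range fun _ : I => ‖b‖) :=
  ⟨‖b‖, by rintro _ ⟨i, rfl⟩; exact le_rfl⟩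

variable {I H K A : Type*}
  [NormedAddCommGroup H] [InnerProductSpace ℂ H]
  [NormedAddCommGroup K] [InnerProductSpace ℂ K]

theorem summable_diag (b : I → H →L[ℂ] H) {C : ℝ} (hC : ∀ i, ‖b i‖ ≤ C) (f : L2 I H) :
    Summable fun i => ‖b i (f i)‖ ^ 2 := by
  refine (f.summable_sq.mul_left (C ^ 2)).of_nonneg_of_le (fun i => by positivity) fun i => ?_
  rw [← mul_pow]
  gcongr
  exact (b i).le_of_opNorm_le (hC i) _

/-- The diagonal operator `∑ᵢ δ_i ⊗ b_i` on `ℓ²(I) ⊗ H`, for a bounded family `(b_i)` of operators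
on `H`. -/
def diagOp (b : I → H →L[ℂ] H) (hb : BddAbove (Set.range fun i => ‖b i‖)) :
    L2 I H →L[ℂ] L2 I H :=
  LinearMap.mkContinuous
    { toFun := fun f => ⟨fun i => b i (f i), memℓp_two_iff.2
        (summable_diag b (fun i => hb.choose_spec (Set.mem_range_self i)) f)⟩
      map_add' := fun f g => by ext i; exact map_add (b i) (f i) (g i)
      map_smul' := fun c f => by ext i; exact map_smul (b i) c (f i) }
    |hb.choose| fun f => by
      have hC : ∀ i, ‖b i‖ ≤ |hb.choose| := fun i =>
        (hb.choose_spec (Set.mem_range_self i)).trans (le_abs_self _)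
      rw [← sq_le_sq₀ (norm_nonneg _) (by positivity), mul_pow, L2.norm_sq, L2.norm_sq,
        ← tsum_mul_left]
      refine (summable_diag b hC f).tsum_le_tsum (fun i => ?_) (f.summable_sq.mul_left _)
      rw [← mul_pow]
      gcongr
      exact (b i).le_of_opNorm_le (hC i) _

@[simp] theorem diagOp_apply (b : I → H →L[ℂ] H) (hb : BddAbove (Set.range fun i => ‖b i‖))
    (f : L2 I H) (i : I) : diagOp b hb f i = b i (f i) := rfl

theorem coord_comp_single_self (i : I) :
    (coord i ∘L single i : H →L[ℂ] H) = ContinuousLinearMap.id ℂ H := by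
  ext x
  exact single_apply_self i x

theorem coord_comp_single_ne {i j : I} (h : i ≠ j) :
    (coord i ∘L single j : H →L[ℂ] H) = 0 := by
  ext x
  exact single_apply_ne h x

open scoped Classical in
theorem entry_diagOp (b : I → H →L[ℂ] H) (hb : BddAbove (Set.range fun i => ‖b i‖)) (i j : I) :
    entry (diagOp b hb) i j = if i = j then b i else 0 := by
  ext x
  change b i ((single j x : L2 I H) i) = _
  split_ifs with h
  · subst h; rw [single_apply_self]
  · rw [single_apply_ne h]; simp

/-- The projection of `ℓ²(I) ⊗ H` onto `ℓ²(F) ⊗ H`. -/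
def cutoff (F : Finset I) : L2 I H →L[ℂ] L2 I H := ∑ i : F, single i.1 ∘L coord i.1

theorem norm_coord_cutoff_le (F : Finset I) (f : L2 I H) (i : I) :
    ‖cutoff F f i‖ ≤ ‖f i‖ := by
  classical
  have h : coord i ∘L (cutoff F : L2 I H →L[ℂ] L2 I H) = if i ∈ F then coord i else 0 := by
    simp only [cutoff, ContinuousLinearMap.comp_finsetSum]
    rw [Finset.sum_coe_sort F
      (fun j => coord i ∘L (single j ∘L coord j : L2 I H →L[ℂ] L2 I H))]
    have key : ∀ j, coord i ∘L (single j ∘L coord j : L2 I H →L[ℂ] L2 I H) =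
        if i = j then coord j else 0 := by
      intro j
      change (coord i ∘L single j) ∘L coord j = _
      split_ifs with h
      · subst h; rw [coord_comp_single_self]; rfl
      · rw [coord_comp_single_ne h]; simp
    simp [key]
  have h2 := DFunLike.congr_fun h f
  change cutoff F f i = _ at h2
  rw [h2]
  split_ifs
  · rfl
  · simp

theorem norm_cutoff_le (F : Finset I) : ‖(cutoff F : L2 I H →L[ℂ] L2 I H)‖ ≤ 1 := by
  classical
  refine ContinuousLinearMap.opNorm_le_bound _ zero_le_one fun f => ?_
  rw [one_mul, ← sq_le_sq₀ (norm_nonneg _) (norm_nonneg _), L2.norm_sq, L2.norm_sq]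
  refine (L2.summable_sq _).tsum_le_tsum (fun i => ?_) f.summable_sq
  gcongr
  exact norm_coord_cutoff_le F f i

variable [CompleteSpace H] [CompleteSpace K]

/-- The amplification `b ↦ 1 ⊗ b` from `B(H)` to `B(ℓ²(I) ⊗ H)`. -/
def oneTensor (I : Type*) {H : Type*} [NormedAddCommGroup H] [InnerProductSpace ℂ H]
    [CompleteSpace H] : (H →L[ℂ] H) →⋆ₐ[ℂ] (L2 I H →L[ℂ] L2 I H) where
  toFun b := diagOp (fun _ => b) (bddAbove_const b)
  map_one' := by ext f i; rfl
  map_mul' a b := by ext f i; rfl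
  map_zero' := by ext f i; rfl
  map_add' a b := by ext f i; rfl
  commutes' c := by ext f i; rfl
  map_star' b := by
    refine entry_ext fun i j => ?_
    rw [entry_star]
    refine (entry_diagOp _ (bddAbove_const (star b)) i j).trans ?_
    refine Eq.trans ?_ (congrArg star (entry_diagOp _ (bddAbove_const b) j i)).symm
    by_cases h : i = j
    · rw [if_pos h, if_pos h.symm]
    · rw [if_neg h, if_neg (Ne.symm h), star_zero]

@[simp] theorem oneTensor_apply (b : H →L[ℂ] H) (f : L2 I H) (i : I) :
    oneTensor (H := H) I b f i = b (f i) := rfl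

open scoped Classical in
theorem entry_oneTensor (b : H →L[ℂ] H) (i j : I) :
    entry (oneTensor (H := H) I b) i j = if i = j then b else 0 :=
  entry_diagOp _ (bddAbove_const b) i j

theorem adjoint_single (i : I) :
    ContinuousLinearMap.adjoint (single i : H →L[ℂ] L2 I H) = coord i := by
  symm
  rw [ContinuousLinearMap.eq_adjoint_iff]
  intro f x
  rw [inner_single_right, coord_apply]

theorem adjoint_coord (i : I) :
    ContinuousLinearMap.adjoint (coord i : L2 I H →L[ℂ] H) = single i := by
  rw [← adjoint_single, ContinuousLinearMap.adjoint_adjoint]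

variable [NonUnitalCStarAlgebra A]

/-- For a homomorphism `ρ : A → B(H)` and a finite `F ⊆ I`, the induced representation of the
matrix algebra `M_F(A)` on `ℓ²(I) ⊗ H`. -/
def blockHom (ρ : A →⋆ₙₐ[ℂ] (H →L[ℂ] H)) (F : Finset I) :
    CStarMatrix F F A →⋆ₙₐ[ℂ] (L2 I H →L[ℂ] L2 I H) where
  toFun M := ∑ i : F, ∑ j : F, single i.1 ∘L ρ (M i j) ∘L coord j.1
  map_smul' c M := by
    simp [Finset.smul_sum]
  map_zero' := by simp
  map_add' M N := by
    simp [Finset.sum_add_distrib, ContinuousLinearMap.add_comp, ContinuousLinearMap.comp_add]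
  map_mul' M N := by
    classical
    have key : ∀ i j k l : F, (single i.1 ∘L ρ (M i j) ∘L coord j.1 : L2 I H →L[ℂ] L2 I H) *
        (single k.1 ∘L ρ (N k l) ∘L coord l.1) =
        if k = j then single i.1 ∘L (ρ (M i j) * ρ (N j l)) ∘L coord l.1 else 0 := by
      intro i j k l
      change single i.1 ∘L ρ (M i j) ∘L (coord j.1 ∘L single k.1) ∘L ρ (N k l) ∘L coord l.1 = _
      split_ifs with h
      · subst h
        rw [coord_comp_single_self]
        rfl
      · rw [coord_comp_single_ne (fun h' => h (Subtype.ext h'.symm))]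
        simp
    simp only [Finset.sum_mul, Finset.mul_sum, key, Finset.sum_ite_eq, Finset.mem_univ, if_true]
    simp only [CStarMatrix.mul_apply, map_sum, map_mul, ContinuousLinearMap.finsetSum_comp, ContinuousLinearMap.comp_finsetSum]
    refine (Finset.sum_congr rfl fun i _ => Finset.sum_comm).trans ?_
    exact Finset.sum_comm.trans (Finset.sum_congr rfl fun i _ => Finset.sum_comm)
  map_star' M := by
    simp only [ContinuousLinearMap.star_eq_adjoint, map_sum, ContinuousLinearMap.adjoint_comp]
    rw [Finset.sum_comm]
    refine Finset.sum_congr rfl fun i _ => Finset.sum_congr rfl fun j _ => ?_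
    rw [CStarMatrix.star_apply, map_star, adjoint_single, adjoint_coord,
      ContinuousLinearMap.star_eq_adjoint]
    rfl

theorem entry_blockHom (ρ : A →⋆ₙₐ[ℂ] (H →L[ℂ] H)) (F : Finset I) (M : CStarMatrix F F A)
    (i j : F) : entry (blockHom ρ F M) i j = ρ (M i j) := by
  classical
  have key : ∀ k l : F, (coord i.1 ∘L (single k.1 ∘L ρ (M k l) ∘L coord l.1) ∘L single j.1 :
      H →L[ℂ] H) = if k = i then (if l = j then ρ (M k l) else 0) else 0 := by
    intro k l
    change (coord i.1 ∘L single k.1) ∘L ρ (M k l) ∘L (coord l.1 ∘L single j.1) = _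
    split_ifs with h h'
    · subst h h'; rw [coord_comp_single_self, coord_comp_single_self]; rfl
    · rw [coord_comp_single_ne (fun h'' => h' (Subtype.ext h''))]; simp
    · rw [coord_comp_single_ne (fun h'' => h (Subtype.ext h''.symm))]; simp
  change coord i.1 ∘L (∑ k : F, ∑ l : F, single k.1 ∘L ρ (M k l) ∘L coord l.1) ∘L single j.1 = _
  simp only [ContinuousLinearMap.finsetSum_comp, ContinuousLinearMap.comp_finsetSum, key]
  simp

theorem norm_blockHom_le (π : A →⋆ₙₐ[ℂ] (H →L[ℂ] H)) (hπ : Function.Injective π)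
    (ρ : A →⋆ₙₐ[ℂ] (K →L[ℂ] K)) (F : Finset I) (M : CStarMatrix F F A) :
    ‖blockHom ρ F M‖ ≤ ‖blockHom π F M‖ := by
  let _ := CStarAlgebra.spectralOrder A
  have := CStarAlgebra.spectralOrderedRing A
  have hinj : Function.Injective (blockHom (I := I) π F) := by
    intro M N h
    ext i j
    apply hπ
    rw [← entry_blockHom, h, entry_blockHom]
  rw [NonUnitalStarAlgHom.norm_map (blockHom π F) hinj]
  exact NonUnitalStarAlgHom.norm_apply_le _ _

theorem blockHom_eq_cutoff (π : A →⋆ₙₐ[ℂ] (H →L[ℂ] H)) (F : Finset I) (T : L2 I H →L[ℂ] L2 I H)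
    (m : I → I → A) (hm : ∀ i j, entry T i j = π (m i j)) :
    blockHom π F (CStarMatrix.ofMatrix fun i j => m i j) = cutoff F ∘L T ∘L cutoff F := by
  simp only [cutoff, ContinuousLinearMap.finsetSum_comp, ContinuousLinearMap.comp_finsetSum]
  change ∑ i : F, ∑ j : F, single i.1 ∘L π (m i j) ∘L coord j.1 = _
  simp only [← hm]
  rw [Finset.sum_comm]
  rfl

/-- The core of the functoriality of minimal tensor products: if `π` is faithful and `T` has matrix
coefficients `π (m i j)`, there is a bounded operator with matrix coefficients `φ (m i j)`. -/
theorem exists_entrywise (π : A →⋆ₙₐ[ℂ] (H →L[ℂ] H)) (hπ : Function.Injective π)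
    (φ : A →⋆ₙₐ[ℂ] (K →L[ℂ] K)) (T : L2 I H →L[ℂ] L2 I H)
    (m : I → I → A) (hm : ∀ i j, entry T i j = π (m i j)) :
    ∃ S : L2 I K →L[ℂ] L2 I K, (∀ i j, entry S i j = φ (m i j)) ∧ ‖S‖ ≤ ‖T‖ := by
  classical
  let B : Finset I → L2 I K →L[ℂ] L2 I K :=
    fun F => blockHom φ F (CStarMatrix.ofMatrix fun i j => m i j)
  have hB : ∀ F, ‖B F‖ ≤ ‖T‖ := by
    intro F
    refine (norm_blockHom_le π hπ φ F _).trans ?_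
    rw [blockHom_eq_cutoff π F T m hm]
    calc ‖cutoff F ∘L T ∘L cutoff F‖ ≤ ‖(cutoff F : L2 I H →L[ℂ] L2 I H)‖ * (‖T‖ * ‖(cutoff F : L2 I H →L[ℂ] L2 I H)‖) :=
          (ContinuousLinearMap.opNorm_comp_le _ _).trans
            (mul_le_mul_of_nonneg_left (ContinuousLinearMap.opNorm_comp_le _ _) (norm_nonneg _))
      _ ≤ 1 * (‖T‖ * 1) := by gcongr <;> exact norm_cutoff_le F
      _ = ‖T‖ := by ring
  let 𝒰 : Ultrafilter (Finset I) := Ultrafilter.of Filter.atTop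
  have h𝒰 : (𝒰 : Filter (Finset I)) ≤ Filter.atTop := Ultrafilter.of_le _
  have hbd : ∀ u v F, ‖⟪B F u, v⟫_ℂ‖ ≤ ‖T‖ * ‖u‖ * ‖v‖ := by
    intro u v F
    refine (norm_inner_le_norm _ _).trans ?_
    gcongr
    exact (B F).le_of_opNorm_le (hB F) u
  have hlim : ∀ u v, ∃ z : ℂ, Filter.Tendsto (fun F => ⟪B F u, v⟫_ℂ) 𝒰 (nhds z) := by
    intro u v
    have hc : IsCompact (Metric.closedBall (0 : ℂ) (‖T‖ * ‖u‖ * ‖v‖)) := isCompact_closedBall _ _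
    obtain ⟨z, -, hz⟩ := hc.ultrafilter_le_nhds (𝒰.map fun F => ⟪B F u, v⟫_ℂ) (by
      rw [Filter.le_principal_iff]
      exact Filter.Eventually.of_forall (f := (𝒰 : Filter (Finset I))) fun F => by simpa using hbd u v F)
    exact ⟨z, hz⟩
  choose β hβ using hlim
  let Bil : L2 I K →L⋆[ℂ] L2 I K →L[ℂ] ℂ :=
    LinearMap.mkContinuous₂
      (LinearMap.mk₂'ₛₗ (starRingEnd ℂ) (RingHom.id ℂ) β
        (fun u u' v => tendsto_nhds_unique (hβ (u + u') v) (by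
          simpa [inner_add_left] using (hβ u v).add (hβ u' v)))
        (fun c u v => tendsto_nhds_unique (hβ (c • u) v) (by
          simpa only [map_smul, inner_smul_left, smul_eq_mul] using (hβ u v).const_mul (conj c)))
        (fun u v v' => tendsto_nhds_unique (hβ u (v + v')) (by
          simpa [inner_add_right] using (hβ u v).add (hβ u v')))
        (fun c u v => tendsto_nhds_unique (hβ u (c • v)) (by
          simpa [inner_smul_right] using (hβ u v).const_mul c)))
      ‖T‖ (fun u v => le_of_tendsto (hβ u v).norm
        (Filter.Eventually.of_forall fun F => hbd u v F))
  have hBil : ∀ u v, Bil u v = β u v := fun u v => rfl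
  refine ⟨InnerProductSpace.continuousLinearMapOfBilin Bil, fun i j => ?_, ?_⟩
  · ext x
    refine ext_inner_right ℂ fun y => ?_
    rw [entry_apply, ← inner_single_right, InnerProductSpace.continuousLinearMapOfBilin_apply, hBil]
    refine tendsto_nhds_unique (hβ _ _) ?_
    refine tendsto_const_nhds.congr' ?_
    refine h𝒰 ?_
    filter_upwards [Filter.eventually_ge_atTop ({i, j} : Finset I)] with F hF
    have hi : i ∈ F := hF (by simp)
    have hj : j ∈ F := hF (by simp)
    have := entry_blockHom φ F (CStarMatrix.ofMatrix fun i j => m i j) ⟨i, hi⟩ ⟨j, hj⟩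
    rw [inner_single_right, ← entry_apply, this]
    rfl
  · refine ContinuousLinearMap.opNorm_le_bound _ (norm_nonneg _) fun u => ?_
    set w := InnerProductSpace.continuousLinearMapOfBilin Bil u with hw
    have h1 : ‖⟪w, w⟫_ℂ‖ ≤ ‖T‖ * ‖u‖ * ‖w‖ := by
      conv_lhs => rw [hw, InnerProductSpace.continuousLinearMapOfBilin_apply, hBil]
      exact le_of_tendsto (hβ u w).norm (Filter.Eventually.of_forall fun F => hbd u w F)
    rw [inner_self_eq_norm_sq_to_K] at h1
    have h2 : ‖w‖ * ‖w‖ ≤ ‖T‖ * ‖u‖ * ‖w‖ := by simpa [sq] using h1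
    rcases (norm_nonneg w).eq_or_lt with h0 | h0
    · rw [← h0]; positivity
    · exact le_of_mul_le_mul_right h2 h0

end Amplification

section MinimalTensor

variable {I H K A : Type*}
  [NormedAddCommGroup H] [InnerProductSpace ℂ H] [CompleteSpace H]
  [NormedAddCommGroup K] [InnerProductSpace ℂ K] [CompleteSpace K]
  [NonUnitalCStarAlgebra A]

/-- Entrywise application of a homomorphism `φ : A → B(K)`: if `π : A → B(H)` is faithful and `T` is
an operator on `ℓ²(I) ⊗ H` whose matrix coefficients lie in `π(A)`, this is the operator on
`ℓ²(I) ⊗ K` with matrix coefficients `φ (π⁻¹ (T i j))`, i.e. "`(ι ⊗ φ π⁻¹)(T)`". -/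
def entrywise (π : A →⋆ₙₐ[ℂ] (H →L[ℂ] H)) (hπ : Function.Injective π)
    (φ : A →⋆ₙₐ[ℂ] (K →L[ℂ] K)) (T : L2 I H →L[ℂ] L2 I H)
    (hT : ∀ i j, ∃ a, π a = entry T i j) : L2 I K →L[ℂ] L2 I K :=
  (exists_entrywise π hπ φ T (fun i j => (hT i j).choose)
    (fun i j => (hT i j).choose_spec.symm)).choose

theorem entry_entrywise (π : A →⋆ₙₐ[ℂ] (H →L[ℂ] H)) (hπ : Function.Injective π)
    (φ : A →⋆ₙₐ[ℂ] (K →L[ℂ] K)) (T : L2 I H →L[ℂ] L2 I H)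
    (hT : ∀ i j, ∃ a, π a = entry T i j) {i j : I} {a : A} (ha : π a = entry T i j) :
    entry (entrywise π hπ φ T hT) i j = φ a := by
  refine ((exists_entrywise π hπ φ T (fun i j => (hT i j).choose)
    (fun i j => (hT i j).choose_spec.symm)).choose_spec.1 i j).trans ?_
  congr 1
  exact hπ ((hT i j).choose_spec.trans ha.symm)

theorem norm_entrywise_le (π : A →⋆ₙₐ[ℂ] (H →L[ℂ] H)) (hπ : Function.Injective π)
    (φ : A →⋆ₙₐ[ℂ] (K →L[ℂ] K)) (T : L2 I H →L[ℂ] L2 I H)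
    (hT : ∀ i j, ∃ a, π a = entry T i j) : ‖entrywise π hπ φ T hT‖ ≤ ‖T‖ :=
  (exists_entrywise π hπ φ T (fun i j => (hT i j).choose)
    (fun i j => (hT i j).choose_spec.symm)).choose_spec.2

/-- The homomorphism `ℂ → B(K)`, `z ↦ z 1`. -/
def scalarHom (K : Type*) [NormedAddCommGroup K] [InnerProductSpace ℂ K] [CompleteSpace K] :
    ℂ →⋆ₙₐ[ℂ] (K →L[ℂ] K) where
  toFun z := z • 1
  map_smul' c z := by simp [mul_smul]
  map_zero' := by simp
  map_add' z w := add_smul z w 1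
  map_mul' z w := by simp [mul_smul, smul_comm z w]
  map_star' z := by simp

theorem scalarHom_injective : Function.Injective (scalarHom ℂ) := by
  intro z w h
  have := DFunLike.congr_fun h 1
  simpa [scalarHom] using this

/-- The matrix coefficient `⟨δ_i, S δ_j⟩` of an operator on `ℓ²(I)`. -/
def coeff (S : L2 I ℂ →L[ℂ] L2 I ℂ) (i j : I) : ℂ := S (single j 1) i

theorem scalarHom_coeff (S : L2 I ℂ →L[ℂ] L2 I ℂ) (i j : I) :
    scalarHom ℂ (coeff S i j) = entry S i j := by
  ext
  simp [scalarHom, coeff, entry]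

/-- The amplification `S ↦ S ⊗ 1` from `B(ℓ²(I))` to `B(ℓ²(I) ⊗ K)`. -/
def tensorOne (K : Type*) [NormedAddCommGroup K] [InnerProductSpace ℂ K] [CompleteSpace K]
    (S : L2 I ℂ →L[ℂ] L2 I ℂ) : L2 I K →L[ℂ] L2 I K :=
  entrywise (scalarHom ℂ) scalarHom_injective (scalarHom K) S
    (fun i j => ⟨coeff S i j, scalarHom_coeff S i j⟩)

theorem entry_tensorOne (S : L2 I ℂ →L[ℂ] L2 I ℂ) (i j : I) :
    entry (tensorOne K S) i j = coeff S i j • 1 :=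
  entry_entrywise _ _ _ _ _ (scalarHom_coeff S i j)

theorem norm_tensorOne_le (S : L2 I ℂ →L[ℂ] L2 I ℂ) : ‖tensorOne K S‖ ≤ ‖S‖ :=
  norm_entrywise_le _ _ _ _ _

/-- The operator `S ⊗ b` on `ℓ²(I) ⊗ H`, for `S ∈ B(ℓ²(I))` and `b ∈ B(H)`. -/
def tensorOp (S : L2 I ℂ →L[ℂ] L2 I ℂ) (b : H →L[ℂ] H) : L2 I H →L[ℂ] L2 I H :=
  tensorOne H S * oneTensor (H := H) I b

theorem entry_tensorOp (S : L2 I ℂ →L[ℂ] L2 I ℂ) (b : H →L[ℂ] H) (i j : I) :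
    entry (tensorOp S b) i j = coeff S i j • b := by
  classical
  ext x
  refine (hasSum_entry_mul (tensorOne H S) (oneTensor (H := H) I b) i j x).unique ?_
  have : ∀ k, entry (tensorOne H S) i k (entry (oneTensor (H := H) I b) k j x) =
      if k = j then (coeff S i j • b) x else 0 := by
    intro k
    rw [entry_oneTensor, entry_tensorOne]
    split_ifs with h
    · subst h; rfl
    · simp
  simp only [this]
  exact hasSum_ite_eq j _

theorem hasSum_coeff_mul (S T : L2 I ℂ →L[ℂ] L2 I ℂ) (i j : I) :
    HasSum (fun k => coeff S i k * coeff T k j) (coeff (S * T) i j) := by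
  have := hasSum_entry_mul S T i j 1
  simpa [← scalarHom_coeff, scalarHom] using this

theorem tensorOp_mul (S T : L2 I ℂ →L[ℂ] L2 I ℂ) (a b : H →L[ℂ] H) :
    tensorOp S a * tensorOp T b = tensorOp (S * T) (a * b) := by
  refine entry_ext fun i j => ?_
  ext x
  refine (hasSum_entry_mul _ _ i j x).unique ?_
  simp only [entry_tensorOp]
  have h := (hasSum_coeff_mul S T i j).smul_const ((a * b) x)
  have e : ∀ k, (coeff S i k • a) ((coeff T k j • b) x) = (coeff S i k * coeff T k j) • (a * b) x := by
    intro k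
    change coeff S i k • a (coeff T k j • b x) = (coeff S i k * coeff T k j) • a (b x)
    rw [map_smul, smul_smul]
  simp only [e]
  exact h

theorem tensorOp_star (S : L2 I ℂ →L[ℂ] L2 I ℂ) (a : H →L[ℂ] H) :
    star (tensorOp S a) = tensorOp (star S) (star a) := by
  refine entry_ext fun i j => ?_
  rw [entry_star, entry_tensorOp, entry_tensorOp, star_smul]
  congr 1
  apply scalarHom_injective
  rw [map_star, scalarHom_coeff, scalarHom_coeff, entry_star]

theorem norm_tensorOp_le (S : L2 I ℂ →L[ℂ] L2 I ℂ) (b : H →L[ℂ] H) :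
    ‖tensorOp S b‖ ≤ ‖S‖ * ‖b‖ := by
  refine (norm_mul_le _ _).trans ?_
  gcongr
  · exact norm_tensorOne_le S
  · exact NonUnitalStarAlgHom.norm_apply_le (oneTensor (H := H) I) b

/-- The minimal (spatial) tensor product `C ⊗ D` of C*-algebras `C ⊆ B(ℓ²(I))` and `D ⊆ B(H)`: the
C*-algebra of operators on `ℓ²(I) ⊗ H` generated by the `c ⊗ d`. -/
def minTensor (C : NonUnitalStarSubalgebra ℂ (L2 I ℂ →L[ℂ] L2 I ℂ))
    (D : NonUnitalStarSubalgebra ℂ (H →L[ℂ] H)) :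
    NonUnitalStarSubalgebra ℂ (L2 I H →L[ℂ] L2 I H) :=
  (NonUnitalStarAlgebra.adjoin ℂ {T | ∃ c ∈ C, ∃ d ∈ D, T = tensorOp c d}).topologicalClosure

theorem adjoin_tensorOp (C : NonUnitalStarSubalgebra ℂ (L2 I ℂ →L[ℂ] L2 I ℂ))
    (D : NonUnitalStarSubalgebra ℂ (H →L[ℂ] H)) :
    ((NonUnitalStarAlgebra.adjoin ℂ {T : L2 I H →L[ℂ] L2 I H |
      ∃ c ∈ C, ∃ d ∈ D, T = tensorOp c d} : NonUnitalStarSubalgebra ℂ _) :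
        Set (L2 I H →L[ℂ] L2 I H)) = (Submodule.span ℂ {T : L2 I H →L[ℂ] L2 I H | ∃ c ∈ C, ∃ d ∈ D, T = tensorOp c d} :
        Submodule ℂ (L2 I H →L[ℂ] L2 I H)) := by
  set s := {T : L2 I H →L[ℂ] L2 I H | ∃ c ∈ C, ∃ d ∈ D, T = tensorOp c d} with hs
  have h1 : s ∪ star s = s := by
    refine Set.union_eq_self_of_subset_right ?_
    rintro T ⟨c, hc, d, hd, hT⟩
    refine ⟨star c, star_mem hc, star d, star_mem hd, ?_⟩
    rw [← tensorOp_star, ← hT, star_star]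
  have h2 : (Subsemigroup.closure s : Set (L2 I H →L[ℂ] L2 I H)) = s := by
    refine Set.Subset.antisymm ?_ Subsemigroup.subset_closure
    intro T hT
    induction hT using Subsemigroup.closure_induction with
    | mem x hx => exact hx
    | mul x y _ _ hx hy =>
      obtain ⟨c, hc, d, hd, rfl⟩ := hx
      obtain ⟨c', hc', d', hd', rfl⟩ := hy
      exact ⟨c * c', mul_mem hc hc', d * d', mul_mem hd hd', tensorOp_mul _ _ _ _⟩
  have h3 := NonUnitalStarAlgebra.adjoin_eq_span (R := ℂ) s
  rw [h1, h2] at h3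
  rw [← h3]
  rfl

theorem coe_minTensor (C : NonUnitalStarSubalgebra ℂ (L2 I ℂ →L[ℂ] L2 I ℂ))
    (D : NonUnitalStarSubalgebra ℂ (H →L[ℂ] H)) :
    (minTensor C D : Set (L2 I H →L[ℂ] L2 I H)) =
      closure (Submodule.span ℂ {T | ∃ c ∈ C, ∃ d ∈ D, T = tensorOp c d} :
        Submodule ℂ (L2 I H →L[ℂ] L2 I H)) := by
  rw [← adjoin_tensorOp]
  rfl

theorem norm_entry_le (T : L2 I H →L[ℂ] L2 I H) (i j : I) : ‖entry T i j‖ ≤ ‖T‖ := by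
  refine ContinuousLinearMap.opNorm_le_bound _ (norm_nonneg _) fun x => ?_
  calc ‖T (single j x) i‖ ≤ ‖T (single j x)‖ := lp.norm_apply_le_norm (by norm_num) _ i
    _ ≤ ‖T‖ * ‖x‖ := by simpa [norm_single_apply] using T.le_opNorm (single j x)

/-- The matrix coefficients of an element of `C ⊗ π(A)` belong to `π(A)`. -/
theorem exists_entry_of_mem_minTensor (C : NonUnitalStarSubalgebra ℂ (L2 I ℂ →L[ℂ] L2 I ℂ))
    (π : A →⋆ₙₐ[ℂ] (H →L[ℂ] H)) (hπ : Function.Injective π) {T : L2 I H →L[ℂ] L2 I H}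
    (hT : T ∈ minTensor C (NonUnitalStarAlgHom.range π)) (i j : I) :
    ∃ a, π a = entry T i j := by
  let E : (L2 I H →L[ℂ] L2 I H) →ₗ[ℂ] (H →L[ℂ] H) :=
    { toFun := fun T => entry T i j
      map_add' := fun S T => by ext x; rfl
      map_smul' := fun c T => by ext x; rfl }
  have hE : Continuous E := AddMonoidHomClass.continuous_of_bound E 1 fun T => by
    rw [one_mul]; exact norm_entry_le T i j
  have hclosed : IsClosed (Set.range π) :=
    (NonUnitalStarAlgHom.isometry π hπ).isClosedEmbedding.isClosed_range
  have hsub : (Submodule.span ℂ {T | ∃ c ∈ C, ∃ d ∈ NonUnitalStarAlgHom.range π,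
      T = tensorOp c d} : Submodule ℂ (L2 I H →L[ℂ] L2 I H)) ≤
      Submodule.comap E (NonUnitalStarAlgHom.range π).toSubmodule := by
    rw [Submodule.span_le]
    rintro _ ⟨c, -, d, hd, rfl⟩
    change entry (tensorOp c d) i j ∈ (NonUnitalStarAlgHom.range π)
    rw [entry_tensorOp]
    exact SMulMemClass.smul_mem _ hd
  have hT' : T ∈ (minTensor C (NonUnitalStarAlgHom.range π) : Set _) := hT
  rw [coe_minTensor] at hT'
  have := closure_minimal (t := E ⁻¹' Set.range π) (fun S hS => ?_) (hclosed.preimage hE) hT'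
  · exact this
  · obtain ⟨a, ha⟩ := hsub hS
    exact ⟨a, ha⟩

variable (C : NonUnitalStarSubalgebra ℂ (L2 I ℂ →L[ℂ] L2 I ℂ))
  (π : A →⋆ₙₐ[ℂ] (H →L[ℂ] H)) (hπ : Function.Injective π) (φ : A →⋆ₙₐ[ℂ] (K →L[ℂ] K))

/-- `ι ⊗ φ` as a map on `C ⊗ π(A)`; see `idTensor` for the homomorphism. -/
def idTensorFun (T : minTensor C (NonUnitalStarAlgHom.range π)) : L2 I K →L[ℂ] L2 I K :=
  entrywise π hπ φ T.1 (exists_entry_of_mem_minTensor C π hπ T.2)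

theorem entry_idTensorFun (T : minTensor C (NonUnitalStarAlgHom.range π)) {i j : I} {a : A}
    (ha : π a = entry T.1 i j) : entry (idTensorFun C π hπ φ T) i j = φ a :=
  entry_entrywise _ _ _ _ _ ha

theorem idTensorFun_tensorOp {c : L2 I ℂ →L[ℂ] L2 I ℂ} {a : A}
    (h : tensorOp c (π a) ∈ minTensor C (NonUnitalStarAlgHom.range π)) :
    idTensorFun C π hπ φ ⟨tensorOp c (π a), h⟩ = tensorOp c (φ a) := by
  refine entry_ext fun i j => ?_
  rw [entry_idTensorFun C π hπ φ _ (a := coeff c i j • a) (by rw [entry_tensorOp, map_smul]),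
    map_smul, entry_tensorOp]

/-- `ι ⊗ φ` as a linear map. -/
def idTensorLinear : minTensor C (NonUnitalStarAlgHom.range π) →ₗ[ℂ] (L2 I K →L[ℂ] L2 I K) where
  toFun := idTensorFun C π hπ φ
  map_add' S T := by
    refine entry_ext fun i j => ?_
    obtain ⟨a, ha⟩ := exists_entry_of_mem_minTensor C π hπ S.2 i j
    obtain ⟨b, hb⟩ := exists_entry_of_mem_minTensor C π hπ T.2 i j
    rw [entry_idTensorFun C π hπ φ _ (a := a + b) (by rw [map_add, ha, hb]; rfl), map_add]
    have : entry (idTensorFun C π hπ φ S + idTensorFun C π hπ φ T) i j =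
      entry (idTensorFun C π hπ φ S) i j + entry (idTensorFun C π hπ φ T) i j := by ext x; rfl
    rw [this, entry_idTensorFun C π hπ φ _ ha, entry_idTensorFun C π hπ φ _ hb]
  map_smul' c T := by
    refine entry_ext fun i j => ?_
    obtain ⟨a, ha⟩ := exists_entry_of_mem_minTensor C π hπ T.2 i j
    rw [entry_idTensorFun C π hπ φ _ (a := c • a) (by rw [map_smul, ha]; rfl), map_smul]
    have : entry (c • idTensorFun C π hπ φ T) i j =
      c • entry (idTensorFun C π hπ φ T) i j := by ext x; rfl
    rw [RingHom.id_apply, this, entry_idTensorFun C π hπ φ _ ha]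

theorem continuous_idTensorLinear : Continuous (idTensorLinear C π hπ φ) :=
  AddMonoidHomClass.continuous_of_bound (idTensorLinear C π hπ φ) 1 fun T => by
    rw [one_mul]
    exact norm_entrywise_le π hπ φ T.1 (exists_entry_of_mem_minTensor C π hπ T.2)

theorem idTensorFun_star (T : minTensor C (NonUnitalStarAlgHom.range π)) :
    idTensorFun C π hπ φ (star T) = star (idTensorFun C π hπ φ T) := by
  refine entry_ext fun i j => ?_
  obtain ⟨a, ha⟩ := exists_entry_of_mem_minTensor C π hπ T.2 j i
  rw [entry_star, entry_idTensorFun C π hπ φ _ ha,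
    entry_idTensorFun C π hπ φ _ (a := star a) (by rw [map_star, ha, ← entry_star]; rfl), map_star]

theorem tensorOp_mem_minTensor {c : L2 I ℂ →L[ℂ] L2 I ℂ} (hc : c ∈ C) (a : A) :
    tensorOp c (π a) ∈ minTensor C (NonUnitalStarAlgHom.range π) :=
  NonUnitalStarSubalgebra.le_topologicalClosure _
    (NonUnitalStarAlgebra.subset_adjoin ℂ _ ⟨c, hc, _, ⟨a, rfl⟩, rfl⟩)

/-- The elementary tensors in `C ⊗ π(A)`. -/
def elementaryTensors : Set (minTensor C (NonUnitalStarAlgHom.range π)) :=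
  {T | ∃ c ∈ C, ∃ a, T.1 = tensorOp c (π a)}

theorem dense_span_elementaryTensors :
    Dense (Submodule.span ℂ (elementaryTensors C π) : Set (minTensor C (NonUnitalStarAlgHom.range π))) := by
  have himage : Subtype.val '' elementaryTensors C π =
      {T : L2 I H →L[ℂ] L2 I H | ∃ c ∈ C, ∃ d ∈ NonUnitalStarAlgHom.range π, T = tensorOp c d} := by
    ext T
    constructor
    · rintro ⟨T, ⟨c, hc, a, hT⟩, rfl⟩; exact ⟨c, hc, _, ⟨a, rfl⟩, hT⟩
    · rintro ⟨c, hc, _, ⟨a, rfl⟩, rfl⟩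
      exact ⟨⟨_, tensorOp_mem_minTensor C π hc a⟩, ⟨c, hc, a, rfl⟩, rfl⟩
  have hspan : Subtype.val '' (Submodule.span ℂ (elementaryTensors C π) : Set (minTensor C (NonUnitalStarAlgHom.range π))) =
      (Submodule.span ℂ {T : L2 I H →L[ℂ] L2 I H | ∃ c ∈ C, ∃ d ∈ NonUnitalStarAlgHom.range π,
        T = tensorOp c d} : Submodule ℂ _) := by
    rw [← himage]
    exact congrArg (fun S : Submodule ℂ (L2 I H →L[ℂ] L2 I H) => (S : Set (L2 I H →L[ℂ] L2 I H))) (Submodule.map_span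
      (minTensor C (NonUnitalStarAlgHom.range π)).toSubmodule.subtype (elementaryTensors C π))
  intro T
  rw [closure_subtype, hspan, ← coe_minTensor]
  exact T.2

/-- A continuous linear map which is multiplicative on a set with dense span is multiplicative. -/
theorem map_mul_of_dense {M B : Type*} [NonUnitalRing M] [Module ℂ M] [TopologicalSpace M]
    [ContinuousMul M] [IsScalarTower ℂ M M] [SMulCommClass ℂ M M] [NormedRing B] [NormedAlgebra ℂ B]
    (L : M →ₗ[ℂ] B) (hL : Continuous L) (s : Set M) (hs : Dense (Submodule.span ℂ s : Set M))
    (h : ∀ x ∈ s, ∀ y ∈ s, L (x * y) = L x * L y) (x y : M) : L (x * y) = L x * L y := by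
  have key : ∀ x ∈ Submodule.span ℂ s, ∀ y ∈ Submodule.span ℂ s, L (x * y) = L x * L y := by
    intro x hx y hy
    induction hx, hy using Submodule.span_induction₂ with
    | mem_mem x y hx hy => exact h x hx y hy
    | zero_left y hy => simp
    | zero_right x hx => simp
    | add_left x y z hx hy hz h1 h2 => rw [add_mul, map_add, map_add, add_mul, h1, h2]
    | add_right x y z hx hy hz h1 h2 => rw [mul_add, map_add, map_add, mul_add, h1, h2]
    | smul_left r x y hx hy h => rw [smul_mul_assoc, map_smul, map_smul, smul_mul_assoc, h]
    | smul_right r x y hx hy h => rw [mul_smul_comm, map_smul, map_smul, mul_smul_comm, h]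
  have h1 : Continuous fun p : M × M => L (p.1 * p.2) := hL.comp (continuous_fst.mul continuous_snd)
  have h2 : Continuous fun p : M × M => L p.1 * L p.2 :=
    (hL.comp continuous_fst).mul (hL.comp continuous_snd)
  exact congrFun (Continuous.ext_on (hs.prod hs) h1 h2 fun p hp => key p.1 hp.1 p.2 hp.2) (x, y)

theorem idTensorFun_mul (S T : minTensor C (NonUnitalStarAlgHom.range π)) :
    idTensorFun C π hπ φ (S * T) = idTensorFun C π hπ φ S * idTensorFun C π hπ φ T := by
  refine map_mul_of_dense (idTensorLinear C π hπ φ) (continuous_idTensorLinear C π hπ φ)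
    (elementaryTensors C π) (dense_span_elementaryTensors C π) ?_ S T
  rintro ⟨_, _⟩ ⟨c, hc, a, rfl⟩ ⟨_, _⟩ ⟨c', hc', a', rfl⟩
  change idTensorFun C π hπ φ ⟨tensorOp c (π a) * tensorOp c' (π a'), _⟩ =
    idTensorFun C π hπ φ ⟨tensorOp c (π a), _⟩ * idTensorFun C π hπ φ ⟨tensorOp c' (π a'), _⟩
  simp only [tensorOp_mul, ← map_mul]
  rw [idTensorFun_tensorOp, idTensorFun_tensorOp, idTensorFun_tensorOp, tensorOp_mul, map_mul]

/-- For a homomorphism `φ : A → B(K)` of C*-algebras, the homomorphism `ι ⊗ φ` from the minimal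
tensor product `C ⊗ A` (realised through the faithful representation `π`) to `B(ℓ²(I) ⊗ K)`. -/
def idTensor : minTensor C (NonUnitalStarAlgHom.range π) →⋆ₙₐ[ℂ] (L2 I K →L[ℂ] L2 I K) where
  toFun := idTensorFun C π hπ φ
  map_smul' := (idTensorLinear C π hπ φ).map_smul'
  map_zero' := (idTensorLinear C π hπ φ).map_zero
  map_add' := (idTensorLinear C π hπ φ).map_add'
  map_mul' := idTensorFun_mul C π hπ φ
  map_star' := idTensorFun_star C π hπ φ

theorem idTensor_tensorOp {c : L2 I ℂ →L[ℂ] L2 I ℂ} (hc : c ∈ C) (a : A) :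
    idTensor C π hπ φ ⟨tensorOp c (π a), tensorOp_mem_minTensor C π hc a⟩ = tensorOp c (φ a) :=
  idTensorFun_tensorOp C π hπ φ _

end MinimalTensor

section ConjAmp

variable {I H K : Type*}
  [NormedAddCommGroup H] [InnerProductSpace ℂ H] [CompleteSpace H]
  [NormedAddCommGroup K] [InnerProductSpace ℂ K] [CompleteSpace K]

/-- Conjugation `b ↦ U b U^*` by a unitary `U : H → K`. -/
def conjHom (U : H ≃ₗᵢ[ℂ] K) : (H →L[ℂ] H) →⋆ₐ[ℂ] (K →L[ℂ] K) where
  toFun b := U.conjStarAlgEquiv b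
  map_one' := map_one _
  map_mul' := map_mul _
  map_zero' := map_zero _
  map_add' := map_add _
  commutes' c := by
    ext x
    change U (c • U.symm x) = c • x
    rw [map_smul, U.apply_symm_apply]
  map_star' := map_star _

theorem conjHom_apply (U : H ≃ₗᵢ[ℂ] K) (b : H →L[ℂ] H) (f : K) :
    conjHom U b f = U (b (U.symm f)) := rfl

/-- For a unitary `U : ℓ²(I) ⊗ H → K`, the homomorphism `b ↦ U (1 ⊗ b) U^*` from `B(H)` to
`B(K)`. -/
def conjAmp (U : L2 I H ≃ₗᵢ[ℂ] K) : (H →L[ℂ] H) →⋆ₐ[ℂ] (K →L[ℂ] K) :=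
  (conjHom U).comp (oneTensor I)

theorem conjAmp_apply (U : L2 I H ≃ₗᵢ[ℂ] K) (b : H →L[ℂ] H) (f : K) :
    conjAmp U b f = U (oneTensor (H := H) I b (U.symm f)) := rfl

theorem tensorOne_eq (S : L2 I ℂ →L[ℂ] L2 I ℂ) : tensorOne H S = tensorOp S 1 := by
  rw [tensorOp, map_one, mul_one]

end ConjAmp

section Cocycles

/-- A normalised `U(1)`-valued 2-cocycle on the group `Γ`. -/
structure TwoCocycle (Γ : Type*) [Group Γ] where
  /-- the underlying function -/
  toFun : Γ → Γ → Circle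
  cocycle : ∀ g h k, toFun g h * toFun (g * h) k = toFun h k * toFun g (h * k)
  map_one_right : ∀ g, toFun g 1 = 1
  map_one_left : ∀ g, toFun 1 g = 1

variable {Γ : Type*} [Group Γ]

/-- The trivial cocycle. -/
def TwoCocycle.trivial (Γ : Type*) [Group Γ] : TwoCocycle Γ where
  toFun _ _ := 1
  cocycle _ _ _ := rfl
  map_one_right _ := rfl
  map_one_left _ := rfl

/-- The complex conjugate cocycle (the inverse in `U(1)` is the complex conjugate). -/
def TwoCocycle.conj (ω : TwoCocycle Γ) : TwoCocycle Γ where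
  toFun g h := (ω.toFun g h)⁻¹
  cocycle g h k := by rw [← mul_inv, ω.cocycle, mul_inv]
  map_one_right g := by rw [ω.map_one_right, inv_one]
  map_one_left g := by rw [ω.map_one_left, inv_one]

theorem bddAbove_phase (ω : TwoCocycle Γ) (g : Γ) :
    BddAbove (Set.range fun h : Γ =>
      ‖((ω.toFun g (g⁻¹ * h) : ℂ) • (1 : ℂ →L[ℂ] ℂ))‖) :=
  ⟨1, by rintro _ ⟨h, rfl⟩; simp [norm_smul, Circle.norm_coe]⟩

/-- The twisted translation `λ^{(ω)}_g` on `ℓ²(Γ)`, with `λ^{(ω)}_g δ_h = ω(g, h) δ_{gh}`; see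
`lam_single`. -/
def lam (ω : TwoCocycle Γ) (g : Γ) : L2 Γ ℂ →L[ℂ] L2 Γ ℂ :=
  diagOp (fun h => (ω.toFun g (g⁻¹ * h) : ℂ) • (1 : ℂ →L[ℂ] ℂ)) (bddAbove_phase ω g) ∘L
    ((reindex (H := ℂ) (Equiv.mulLeft g⁻¹)).toContinuousLinearEquiv : L2 Γ ℂ →L[ℂ] L2 Γ ℂ)

theorem lam_apply (ω : TwoCocycle Γ) (g h : Γ) (f : L2 Γ ℂ) :
    lam ω g f h = (ω.toFun g (g⁻¹ * h) : ℂ) * f (g⁻¹ * h) := rfl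

theorem lam_single (ω : TwoCocycle Γ) (g h : Γ) (z : ℂ) :
    lam ω g (single h z) = single (g * h) ((ω.toFun g h : ℂ) * z) := by
  classical
  ext k
  rw [lam_apply, single_apply, single_apply]
  by_cases hk : k = g * h
  · subst hk; simp
  · rw [if_neg hk, if_neg (fun h' => hk (by rw [← h', mul_inv_cancel_left])), mul_zero]

open scoped Classical in
theorem coeff_lam (ω : TwoCocycle Γ) (g i j : Γ) :
    coeff (lam ω g) i j = if i = g * j then (ω.toFun g j : ℂ) else 0 := by
  rw [coeff, lam_single, single_apply, mul_one]

theorem norm_lam_le (ω : TwoCocycle Γ) (g : Γ) : ‖lam ω g‖ ≤ 1 := by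
  refine ContinuousLinearMap.opNorm_le_bound _ zero_le_one fun f => ?_
  rw [one_mul]
  refine le_of_eq (L2.norm_eq_of_tsum ?_)
  rw [← (Equiv.mulLeft g⁻¹).tsum_eq fun h => ‖f h‖ ^ 2]
  refine tsum_congr fun h => ?_
  rw [lam_apply, norm_mul, Circle.norm_coe, one_mul]
  rfl

theorem lam_mul (ω : TwoCocycle Γ) (g h : Γ) :
    lam ω g * lam ω h = (ω.toFun g h : ℂ) • lam ω (g * h) := by
  ext f k
  change (ω.toFun g (g⁻¹ * k) : ℂ) * ((ω.toFun h (h⁻¹ * (g⁻¹ * k)) : ℂ) * f (h⁻¹ * (g⁻¹ * k))) =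
    (ω.toFun g h : ℂ) * ((ω.toFun (g * h) ((g * h)⁻¹ * k) : ℂ) * f ((g * h)⁻¹ * k))
  have e : (g * h)⁻¹ * k = h⁻¹ * (g⁻¹ * k) := by rw [mul_inv_rev, mul_assoc]
  have hc := congrArg (fun z : Circle => (z : ℂ)) (ω.cocycle g h (h⁻¹ * (g⁻¹ * k)))
  simp only [Circle.coe_mul, mul_inv_cancel_left] at hc
  rw [e]
  linear_combination (-f (h⁻¹ * (g⁻¹ * k))) * hc

theorem lam_star (ω : TwoCocycle Γ) (g : Γ) :
    star (lam ω g) = ((ω.toFun g g⁻¹)⁻¹ : Circle) • lam ω g⁻¹ := by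
  refine entry_ext fun i j => ?_
  have e : entry (((ω.toFun g g⁻¹)⁻¹ : Circle) • lam ω g⁻¹) i j =
      ((ω.toFun g g⁻¹)⁻¹ : Circle) • entry (lam ω g⁻¹) i j := by ext; rfl
  rw [e, entry_star, ← scalarHom_coeff, ← scalarHom_coeff, ← map_star, coeff_lam, coeff_lam]
  by_cases h : j = g * i
  · subst h
    rw [if_pos rfl, if_pos (inv_mul_cancel_left g i).symm]
    have hc := ω.cocycle g g⁻¹ (g * i)
    rw [mul_inv_cancel, ω.map_one_left, mul_one, inv_mul_cancel_left] at hc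
    rw [hc, mul_inv_rev, Circle.smul_def, ← map_smul]
    congr 1
    rw [Circle.coe_mul, smul_eq_mul, mul_assoc, ← Circle.coe_mul, inv_mul_cancel, Circle.coe_one,
      mul_one, Circle.coe_inv_eq_conj]
    rfl
  · rw [if_neg h, if_neg (fun h' => h (by rw [h', mul_inv_cancel_left])), star_zero, map_zero,
      smul_zero]

theorem exists_ad_lam (ω : TwoCocycle Γ) (k g : Γ) :
    ∃ z : ℂ, lam ω k * lam ω g * star (lam ω k) = z • lam ω (k * g * k⁻¹) := by
  refine ⟨((ω.toFun k k⁻¹)⁻¹ : Circle) * (ω.toFun k g * ω.toFun (k * g) k⁻¹), ?_⟩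
  rw [lam_mul, lam_star, Circle.smul_def, mul_smul_comm, smul_mul_assoc, lam_mul, smul_smul,
    smul_smul, mul_assoc]

/-- The twisted reduced group C*-algebra `C*_{r,ω}(Γ)`: the C*-algebra of operators on `ℓ²(Γ)`
generated by the `λ^{(ω)}_g`. -/
def twistedGroupAlgebra (ω : TwoCocycle Γ) : NonUnitalStarSubalgebra ℂ (L2 Γ ℂ →L[ℂ] L2 Γ ℂ) :=
  (NonUnitalStarAlgebra.adjoin ℂ (Set.range (lam ω))).topologicalClosure

/-- The reduced group C*-algebra `C*_r(Γ)`. -/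
def reducedGroupAlgebra (Γ : Type*) [Group Γ] : NonUnitalStarSubalgebra ℂ (L2 Γ ℂ →L[ℂ] L2 Γ ℂ) :=
  twistedGroupAlgebra (TwoCocycle.trivial Γ)

end Cocycles

section Coactions

variable {Γ H A : Type*} [Group Γ] [NormedAddCommGroup H] [InnerProductSpace ℂ H] [CompleteSpace H]
  [NonUnitalCStarAlgebra A]

theorem tensorOp_lam_apply (ω : TwoCocycle Γ) (g h : Γ) (b : H →L[ℂ] H) (f : L2 Γ H) :
    tensorOp (lam ω g) b f h = (ω.toFun g (g⁻¹ * h) : ℂ) • b (f (g⁻¹ * h)) := by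
  classical
  have h1 := (hasSum_single f).mapL (coord h ∘L tensorOp (lam ω g) b)
  refine h1.unique ?_
  have e : ∀ k, (coord h ∘L tensorOp (lam ω g) b) (single k (f k)) =
      if k = g⁻¹ * h then (ω.toFun g (g⁻¹ * h) : ℂ) • b (f (g⁻¹ * h)) else 0 := by
    intro k
    change entry (tensorOp (lam ω g) b) h k (f k) = _
    rw [entry_tensorOp, coeff_lam]
    by_cases hk : k = g⁻¹ * h
    · subst hk; rw [if_pos (by simp), if_pos rfl]; rfl
    · rw [if_neg hk, if_neg (fun h' => hk (by rw [h', inv_mul_cancel_left]))]; simp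
  simp only [e]
  exact hasSum_ite_eq _ _

/-- The bijection `(s, h) ↦ (h⁻¹ s, h)` of `Γ × Γ`. -/
def shearEquiv (Γ : Type*) [Group Γ] : Γ × Γ ≃ Γ × Γ where
  toFun p := (p.2⁻¹ * p.1, p.2)
  invFun p := (p.2 * p.1, p.2)
  left_inv p := by simp
  right_inv p := by simp

/-- The unitary `δ_s ⊗ δ_h ⊗ ξ ↦ δ_{hs} ⊗ δ_h ⊗ ξ` on `ℓ²(Γ) ⊗ ℓ²(Γ) ⊗ H`. -/
def shear (Γ H : Type*) [Group Γ] [NormedAddCommGroup H] [InnerProductSpace ℂ H] :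
    L2 Γ (L2 Γ H) ≃ₗᵢ[ℂ] L2 Γ (L2 Γ H) := permute (shearEquiv Γ)

/-- The homomorphism `δ_l^{(ω)} ⊗ ι`, for all cocycles `ω` simultaneously: it maps
`λ^{(ω)}_g ⊗ b` to `λ_g ⊗ λ^{(ω)}_g ⊗ b`, see `deltaL_tensorOp`. -/
def deltaL (Γ H : Type*) [Group Γ] [NormedAddCommGroup H] [InnerProductSpace ℂ H]
    [CompleteSpace H] : (L2 Γ H →L[ℂ] L2 Γ H) →⋆ₐ[ℂ] (L2 Γ (L2 Γ H) →L[ℂ] L2 Γ (L2 Γ H)) :=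
  conjAmp (shear Γ H)

theorem deltaL_apply (T : L2 Γ H →L[ℂ] L2 Γ H) (f : L2 Γ (L2 Γ H)) :
    deltaL Γ H T f = shear Γ H (oneTensor (H := L2 Γ H) Γ T ((shear Γ H).symm f)) := rfl

theorem deltaL_tensorOp (ω : TwoCocycle Γ) (g : Γ) (b : H →L[ℂ] H) :
    deltaL Γ H (tensorOp (lam ω g) b) =
      tensorOp (lam (TwoCocycle.trivial Γ) g) (tensorOp (lam ω g) b) := by
  ext f s h
  rw [tensorOp_lam_apply]
  have h1 : (TwoCocycle.trivial Γ).toFun g (g⁻¹ * s) = 1 := rfl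
  rw [h1, Circle.coe_one, one_smul, tensorOp_lam_apply, deltaL_apply]
  change tensorOp (lam ω g) b ((shear Γ H).symm f (h⁻¹ * s)) h = _
  rw [tensorOp_lam_apply]
  have h2 : (shear Γ H).symm f (h⁻¹ * s) (g⁻¹ * h) = f (g⁻¹ * h * (h⁻¹ * s)) (g⁻¹ * h) := rfl
  rw [h2, mul_assoc, mul_inv_cancel_left]

/-- A (continuous) coaction `α : A → C*_r(Γ) ⊗ A` of the compact quantum group `C*_r(Γ)` on the
C*-algebra `A`, which is faithfully represented on `H` by `π`. -/
structure Coaction (Γ : Type*) [Group Γ] (π : A →⋆ₙₐ[ℂ] (H →L[ℂ] H))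
    (hπ : Function.Injective π) where
  /-- the coaction, as a homomorphism into operators on `ℓ²(Γ) ⊗ H` -/
  toHom : A →⋆ₙₐ[ℂ] (L2 Γ H →L[ℂ] L2 Γ H)
  /-- `α` takes values in `C*_r(Γ) ⊗ A` -/
  mem : ∀ a, toHom a ∈ minTensor (reducedGroupAlgebra Γ) (NonUnitalStarAlgHom.range π)
  /-- `(ι ⊗ α) ∘ α = (δ ⊗ ι) ∘ α` -/
  coassoc : ∀ a, idTensor (reducedGroupAlgebra Γ) π hπ toHom ⟨toHom a, mem a⟩ =
    deltaL Γ H (toHom a)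
  /-- the span of `(C*_r(Γ) ⊗ 1) α(A)` is dense in `C*_r(Γ) ⊗ A` -/
  cancellation : closure (Submodule.span ℂ
      {T | ∃ c ∈ reducedGroupAlgebra Γ, ∃ a, T = tensorOne H c * toHom a} :
        Set (L2 Γ H →L[ℂ] L2 Γ H)) =
    minTensor (reducedGroupAlgebra Γ) (NonUnitalStarAlgHom.range π)

end Coactions

section Deformation

variable {Γ H A : Type*} [Group Γ] [NormedAddCommGroup H] [InnerProductSpace ℂ H] [CompleteSpace H]
  [NonUnitalCStarAlgebra A] {π : A →⋆ₙₐ[ℂ] (H →L[ℂ] H)} {hπ : Function.Injective π}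

/-! Operators on `ℓ²(Γ) ⊗ H ⊗ ℓ²(Γ)` are realised on `L2 Γ (L2 Γ H)`: the outer copy of `ℓ²(Γ)` is
the first leg, `H` is the second leg, and the inner copy of `ℓ²(Γ)` is the third leg. -/

/-- `T ↦ T_{12}`, from operators on `ℓ²(Γ) ⊗ H` to operators on `ℓ²(Γ) ⊗ H ⊗ ℓ²(Γ)`. -/
def leg12 (T : L2 Γ H →L[ℂ] L2 Γ H) : L2 Γ (L2 Γ H) →L[ℂ] L2 Γ (L2 Γ H) :=
  conjAmp (flip (I := Γ) (J := Γ) (H := H)) T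

theorem bddAbove_ad (ω : TwoCocycle Γ) (x : L2 Γ ℂ →L[ℂ] L2 Γ ℂ) :
    BddAbove (Set.range fun h : Γ => ‖tensorOne H (lam ω h⁻¹ * x * star (lam ω h⁻¹))‖) := by
  refine ⟨‖x‖, ?_⟩
  rintro _ ⟨h, rfl⟩
  refine (norm_tensorOne_le _).trans ?_
  calc ‖lam ω h⁻¹ * x * star (lam ω h⁻¹)‖ ≤ ‖lam ω h⁻¹‖ * ‖x‖ * ‖star (lam ω h⁻¹)‖ :=
        (norm_mul_le _ _).trans (mul_le_mul_of_nonneg_right (norm_mul_le _ _) (norm_nonneg _))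
    _ ≤ 1 * ‖x‖ * 1 := by
        have h2 : ‖star (lam ω h⁻¹)‖ ≤ 1 :=
          (LinearIsometryEquiv.norm_map ContinuousLinearMap.adjoint (lam ω h⁻¹)).le.trans
            (norm_lam_le ω h⁻¹)
        gcongr
        exact norm_lam_le ω h⁻¹
    _ = ‖x‖ := by ring

/-- The operator `\widetilde{Ad}^{(ω)}(x)_{13} = ∑_h δ_h ⊗ 1 ⊗ Ad^{(ω)}_{h⁻¹}(x)` on
`ℓ²(Γ) ⊗ H ⊗ ℓ²(Γ)`, where `Ad^{(ω)}_g(x) = λ^{(ω)}_g x (λ^{(ω)}_g)^*`. -/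
def adTilde (H : Type*) [NormedAddCommGroup H] [InnerProductSpace ℂ H] [CompleteSpace H]
    (ω : TwoCocycle Γ) (x : L2 Γ ℂ →L[ℂ] L2 Γ ℂ) : L2 Γ (L2 Γ H) →L[ℂ] L2 Γ (L2 Γ H) :=
  diagOp (fun h => tensorOne H (lam ω h⁻¹ * x * star (lam ω h⁻¹))) (bddAbove_ad ω x)

/-- The braided tensor product `A ⊠ C*_{r,ω}(Γ)`: the C*-algebra of operators on
`ℓ²(Γ) ⊗ H ⊗ ℓ²(Γ)` generated by the `α(a)_{12} \widetilde{Ad}^{(ω)}(x)_{13}`. -/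
def braidedTensor (α : Coaction Γ π hπ) (ω : TwoCocycle Γ) :
    NonUnitalStarSubalgebra ℂ (L2 Γ (L2 Γ H) →L[ℂ] L2 Γ (L2 Γ H)) :=
  (NonUnitalStarAlgebra.adjoin ℂ
    {T | ∃ a, ∃ x ∈ twistedGroupAlgebra ω, T = leg12 (α.toHom a) * adTilde H ω x}).topologicalClosure

/-- The unitary `δ_s ⊗ δ_h ⊗ ξ ⊗ δ_t ↦ δ_{hts} ⊗ δ_h ⊗ ξ ⊗ δ_t` on
`ℓ²(Γ) ⊗ ℓ²(Γ) ⊗ H ⊗ ℓ²(Γ)`. -/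
def diagonalUnitary (Γ H : Type*) [Group Γ] [NormedAddCommGroup H] [InnerProductSpace ℂ H] :
    L2 Γ (L2 Γ (L2 Γ H)) ≃ₗᵢ[ℂ] L2 Γ (L2 Γ (L2 Γ H)) :=
  (mapRight flip).trans ((shear Γ (L2 Γ H)).trans ((mapRight flip).trans (shear Γ (L2 Γ H))))

theorem diagonalUnitary_apply {Γ H : Type*} [Group Γ] [NormedAddCommGroup H]
    [InnerProductSpace ℂ H] (f : L2 Γ (L2 Γ (L2 Γ H))) (s h t : Γ) :
    diagonalUnitary Γ H f s h t = f (t⁻¹ * (h⁻¹ * s)) h t := rfl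

theorem diagonalUnitary_symm_apply {Γ H : Type*} [Group Γ] [NormedAddCommGroup H]
    [InnerProductSpace ℂ H] (f : L2 Γ (L2 Γ (L2 Γ H))) (s h t : Γ) :
    (diagonalUnitary Γ H).symm f s h t = f (h * (t * s)) h t := rfl

/-- The diagonal coaction `α ⊗ δ_l^{(ω)}` on the braided tensor product `A ⊠ C*_{r,ω}(Γ)`: the
homomorphism determined by
`α(a)_{12} \widetilde{Ad}(x)_{13} ↦ (δ ⊗ ι)(α(a))_{123} (ι ⊗ \widetilde{Ad})(δ_l(x))_{124}`.
It is implemented by a unitary; see `diagonalCoaction_leg12` and `diagonalCoaction_adTilde` for its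
values on the generators. -/
def diagonalCoaction (Γ H : Type*) [Group Γ] [NormedAddCommGroup H] [InnerProductSpace ℂ H]
    [CompleteSpace H] : (L2 Γ (L2 Γ H) →L[ℂ] L2 Γ (L2 Γ H)) →⋆ₐ[ℂ]
      (L2 Γ (L2 Γ (L2 Γ H)) →L[ℂ] L2 Γ (L2 Γ (L2 Γ H))) :=
  conjAmp (diagonalUnitary Γ H)

theorem diagonalCoaction_apply (T : L2 Γ (L2 Γ H) →L[ℂ] L2 Γ (L2 Γ H))
    (f : L2 Γ (L2 Γ (L2 Γ H))) (s h t : Γ) :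
    diagonalCoaction Γ H T f s h t =
      T ((diagonalUnitary Γ H).symm f (t⁻¹ * (h⁻¹ * s))) h t := rfl

/-- `S ↦ S_{123}`, from operators on `ℓ²(Γ) ⊗ ℓ²(Γ) ⊗ H` to operators on
`ℓ²(Γ) ⊗ ℓ²(Γ) ⊗ H ⊗ ℓ²(Γ)`. -/
def leg123 (S : L2 Γ (L2 Γ H) →L[ℂ] L2 Γ (L2 Γ H)) :
    L2 Γ (L2 Γ (L2 Γ H)) →L[ℂ] L2 Γ (L2 Γ (L2 Γ H)) :=
  conjAmp ((flip (I := Γ) (J := Γ) (H := L2 Γ H)).trans (mapRight flip)) S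

/-- On the first kind of generators the diagonal coaction is `α(a)_{12} ↦ (δ ⊗ ι)(α(a))_{123}`. -/
theorem diagonalCoaction_leg12 (T : L2 Γ H →L[ℂ] L2 Γ H) :
    diagonalCoaction Γ H (leg12 T) = leg123 (deltaL Γ H T) := by
  ext f s h t
  rw [diagonalCoaction_apply]
  refine congrArg (fun u : L2 Γ H => T u h) (lp.ext (E := fun _ : Γ => H) (funext fun k => ?_))
  change f (k * (t * (t⁻¹ * (h⁻¹ * s)))) k t = f (k * (h⁻¹ * s)) k t
  rw [mul_inv_cancel_left]

/-- On the second kind of generators the diagonal coaction is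
`\widetilde{Ad}(x)_{13} ↦ (ι ⊗ \widetilde{Ad})(δ_l(x))_{124}`, where `δ_l(x) = λ_g ⊗ x` for
`x = λ^{(ω)}_g`. -/
theorem diagonalCoaction_adTilde (ω : TwoCocycle Γ) (g : Γ) :
    diagonalCoaction Γ H (adTilde H ω (lam ω g)) =
      tensorOp (lam (TwoCocycle.trivial Γ) g) (adTilde H ω (lam ω g)) := by
  ext f s h t
  have hx : ∃ z : ℂ, tensorOne H (lam ω h⁻¹ * lam ω g * star (lam ω h⁻¹)) =
      tensorOp (lam ω (h⁻¹ * g * h)) (z • 1) := by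
    obtain ⟨z, hz⟩ := exists_ad_lam ω h⁻¹ g
    refine ⟨z, entry_ext fun i j => ?_⟩
    rw [hz, entry_tensorOne, entry_tensorOp, inv_inv, smul_smul, mul_comm]
    rfl
  obtain ⟨z, hx⟩ := hx
  rw [diagonalCoaction_apply, tensorOp_lam_apply]
  change tensorOne H (lam ω h⁻¹ * lam ω g * star (lam ω h⁻¹))
      ((diagonalUnitary Γ H).symm f (t⁻¹ * (h⁻¹ * s)) h) t =
    ((1 : Circle) : ℂ) • tensorOne H (lam ω h⁻¹ * lam ω g * star (lam ω h⁻¹)) (f (g⁻¹ * s) h) t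
  rw [Circle.coe_one, one_smul, hx, tensorOp_lam_apply, tensorOp_lam_apply,
    diagonalUnitary_symm_apply]
  congr 3
  group

/-- The deformation `A_ω = (A ⊠ C*_{r, \bar ω}(Γ))^{C*_r(Γ)}`: the fixed point algebra of the
diagonal coaction, i.e. the algebra of the `T` with `(α ⊗ δ_l)(T) = 1 ⊗ T`. -/
def deformation (α : Coaction Γ π hπ) (ω : TwoCocycle Γ) :
    NonUnitalStarSubalgebra ℂ (L2 Γ (L2 Γ H) →L[ℂ] L2 Γ (L2 Γ H)) where
  carrier := {T | T ∈ braidedTensor α ω.conj ∧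
    diagonalCoaction Γ H T = oneTensor (H := L2 Γ (L2 Γ H)) Γ T}
  add_mem' hS hT := ⟨add_mem hS.1 hT.1, by rw [map_add, map_add, hS.2, hT.2]⟩
  zero_mem' := ⟨zero_mem _, by rw [map_zero, map_zero]⟩
  mul_mem' hS hT := ⟨mul_mem hS.1 hT.1, by rw [map_mul, map_mul, hS.2, hT.2]⟩
  smul_mem' c T hT := ⟨SMulMemClass.smul_mem c hT.1, by rw [map_smul, map_smul, hT.2]⟩
  star_mem' hT := ⟨star_mem hT.1, by rw [map_star, map_star, hT.2]⟩

/-- The subalgebra `A'_ω` of `C*_{r,ω}(Γ) ⊗ A` of the `x` with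
`(ι ⊗ α)(x)_{213} = (δ_l^{(ω)} ⊗ ι)(x)`. -/
def deformationAlt (α : Coaction Γ π hπ) (ω : TwoCocycle Γ) :
    NonUnitalStarSubalgebra ℂ (L2 Γ H →L[ℂ] L2 Γ H) where
  carrier := {x | ∃ hx : x ∈ minTensor (twistedGroupAlgebra ω) (NonUnitalStarAlgHom.range π),
    conjHom (flip (I := Γ) (J := Γ) (H := H))
      (idTensor (twistedGroupAlgebra ω) π hπ α.toHom ⟨x, hx⟩) = deltaL Γ H x}
  add_mem' := by
    rintro x y ⟨hx, hx'⟩ ⟨hy, hy'⟩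
    refine ⟨add_mem hx hy, ?_⟩
    rw [map_add, ← hx', ← hy', ← map_add, ← map_add]
    rfl
  zero_mem' := ⟨zero_mem _, by
    rw [map_zero]
    exact (congrArg _ (map_zero (idTensor (twistedGroupAlgebra ω) π hπ α.toHom))).trans
      (map_zero _)⟩
  mul_mem' := by
    rintro x y ⟨hx, hx'⟩ ⟨hy, hy'⟩
    refine ⟨mul_mem hx hy, ?_⟩
    rw [map_mul, ← hx', ← hy', ← map_mul, ← map_mul]
    rfl
  smul_mem' := by
    rintro c x ⟨hx, hx'⟩
    refine ⟨SMulMemClass.smul_mem c hx, ?_⟩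
    rw [map_smul, ← hx', ← map_smul, ← map_smul]
    rfl
  star_mem' := by
    rintro x ⟨hx, hx'⟩
    refine ⟨star_mem hx, ?_⟩
    rw [map_star, ← hx', ← map_star, ← map_star]
    rfl

end Deformation

end CocycleDeformation

end

/-! Write A_g for the spectral subspace of those a with α(a) = λ_g ⊗ a, and E_g(a) for the slice of
α(a) by ⟨δ_g, · δ_e⟩. Coassociativity puts E_g(a) in A_g, and the cancellation condition makes the
A_g span a dense subspace of A. Thus A is Γ-graded up to closure, and both algebras are determined
by homogeneous generators: A'_ω is the closed span of the λ^{(ω)}_g ⊗ a, and A_ω is the closed span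
of the products of α(a)_{12} and the Ad-tilde of λ^{(ω̄)}_{g⁻¹} in legs 13, in both cases with a in
A_g.

In each case the hard inclusion comes from a slice map: a continuous linear map that is the identity
on elements satisfying the fixed point condition and carries spanning elements of the ambient
algebra to homogeneous generators or to zero (`mem_closedSpan_of_mem_deformationAlt`,
`mem_closedSpan_of_mem_deformation`). For A_ω this also needs the span of the homogeneous products
to be a *-algebra, which follows from the commutation relation `adTilde_mul_leg12`.

The two families are matched by one spatial homomorphism x ↦ U(1 ⊗ x)U*, where U sends δ_m ⊗ δ_s ⊗ ξ
to δ_s ⊗ ξ ⊗ (λ^{(ω̄)}_s)* δ_m. By `conjAmp_deformationUnitary` it maps λ^{(ω)}_g ⊗ a to α(a)_{12}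
times the Ad-tilde of (λ^{(ω̄)}_g)*, and (λ^{(ω̄)}_g)* is a phase times λ^{(ω̄)}_{g⁻¹}. The
homomorphism is injective, hence isometric, so it identifies the two closed spans. -/

noncomputable section

namespace CocycleDeformation

open scoped ComplexConjugate InnerProductSpace

/-! ### Closed linear spans -/

section ClosedSpan

variable {B : Type*} [NormedAddCommGroup B] [NormedSpace ℂ B]
  {B' : Type*} [NormedAddCommGroup B'] [NormedSpace ℂ B']

/-- The closed linear span of a set. -/
def closedSpan (s : Set B) : Submodule ℂ B := (Submodule.span ℂ s).topologicalClosure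

theorem coe_closedSpan (s : Set B) :
    (closedSpan s : Set B) = closure (Submodule.span ℂ s : Set B) := rfl

theorem isClosed_closedSpan (s : Set B) : IsClosed (closedSpan s : Set B) :=
  Submodule.isClosed_topologicalClosure _

theorem span_le_closedSpan (s : Set B) : Submodule.span ℂ s ≤ closedSpan s :=
  Submodule.le_topologicalClosure _

theorem subset_closedSpan {s : Set B} {x : B} (hx : x ∈ s) : x ∈ closedSpan s :=
  span_le_closedSpan s (Submodule.subset_span hx)

/-- A continuous linear map sending `s` into a closed subspace sends the closed span of `s` into
it. -/
theorem map_mem_of_mem_closedSpan {s : Set B} (L : B →ₗ[ℂ] B') (hL : Continuous L)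
    {p : Submodule ℂ B'} (hp : IsClosed (p : Set B')) (h : ∀ x ∈ s, L x ∈ p) {x : B}
    (hx : x ∈ closedSpan s) : L x ∈ p := by
  have : closedSpan s ≤ p.comap L :=
    Submodule.topologicalClosure_minimal _ (Submodule.span_le.2 h) (hp.preimage hL)
  exact this hx

theorem closedSpan_le {s : Set B} {p : Submodule ℂ B} (hp : IsClosed (p : Set B))
    (h : ∀ x ∈ s, x ∈ p) : closedSpan s ≤ p :=
  fun _ hx => map_mem_of_mem_closedSpan LinearMap.id continuous_id hp h hx

end ClosedSpan

/-! ### Generated C*-algebras as closed spans -/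

section Adjoin

variable {B : Type*} [NonUnitalNormedRing B] [StarRing B] [NormedSpace ℂ B] [IsScalarTower ℂ B B]
  [SMulCommClass ℂ B B] [StarModule ℂ B] [NormedStarGroup B]

/-- If the span of `G` is a `*`-algebra, its closure contains the closed `*`-algebra generated by
any of its subsets. -/
theorem topologicalClosure_adjoin_le_closedSpan {G S : Set B}
    (hmul : ∀ x ∈ G, ∀ y ∈ G, x * y ∈ Submodule.span ℂ G)
    (hstar : ∀ x ∈ G, star x ∈ Submodule.span ℂ G) (hS : ∀ x ∈ S, x ∈ closedSpan G) {T : B}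
    (hT : T ∈ (NonUnitalStarAlgebra.adjoin ℂ S).topologicalClosure) : T ∈ closedSpan G := by
  let N : NonUnitalStarSubalgebra ℂ B :=
    { Submodule.span ℂ G with
      mul_mem' := by
        intro x y hx hy
        change x * y ∈ Submodule.span ℂ G
        change x ∈ Submodule.span ℂ G at hx
        change y ∈ Submodule.span ℂ G at hy
        induction hx, hy using Submodule.span_induction₂ with
        | mem_mem x y hx hy => exact hmul x hx y hy
        | zero_left y hy => simp
        | zero_right x hx => simp
        | add_left x y z hx hy hz h1 h2 => rw [add_mul]; exact add_mem h1 h2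
        | add_right x y z hx hy hz h1 h2 => rw [mul_add]; exact add_mem h1 h2
        | smul_left r x y hx hy h => rw [smul_mul_assoc]; exact Submodule.smul_mem _ _ h
        | smul_right r x y hx hy h => rw [mul_smul_comm]; exact Submodule.smul_mem _ _ h
      star_mem' := by
        intro x hx
        change star x ∈ Submodule.span ℂ G
        change x ∈ Submodule.span ℂ G at hx
        induction hx using Submodule.span_induction with
        | mem x hx => exact hstar x hx
        | zero => simp
        | add x y hx hy h1 h2 => rw [star_add]; exact add_mem h1 h2
        | smul r x hx h => rw [star_smul]; exact Submodule.smul_mem _ _ h }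
  -- The elements of `S` lie only in the closure of the span of `G`, so the comparison is made with
  -- the closure of `N`.
  have h1 : NonUnitalStarAlgebra.adjoin ℂ S ≤ N.topologicalClosure :=
    NonUnitalStarAlgebra.adjoin_le hS
  exact NonUnitalStarSubalgebra.topologicalClosure_minimal _ h1
    (NonUnitalStarSubalgebra.isClosed_topologicalClosure N) hT

end Adjoin

/-! ### Matrix coefficients and elementary tensors as continuous linear maps -/

section Entries

variable {I H : Type*} [NormedAddCommGroup H] [InnerProductSpace ℂ H]

/-- `T ↦ entry T i j` as a linear map. -/
def entryLinear (i j : I) : (L2 I H →L[ℂ] L2 I H) →ₗ[ℂ] (H →L[ℂ] H) where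
  toFun T := entry T i j
  map_add' _ _ := by ext; rfl
  map_smul' _ _ := by ext; rfl

theorem entry_add (S T : L2 I H →L[ℂ] L2 I H) (i j : I) :
    entry (S + T) i j = entry S i j + entry T i j := (entryLinear i j).map_add S T

theorem entry_smul (c : ℂ) (T : L2 I H →L[ℂ] L2 I H) (i j : I) :
    entry (c • T) i j = c • entry T i j := (entryLinear i j).map_smul c T

variable [CompleteSpace H]

theorem continuous_entryLinear (i j : I) : Continuous (entryLinear (H := H) i j) :=
  AddMonoidHomClass.continuous_of_bound _ 1 fun T => by
    rw [one_mul]; exact norm_entry_le T i j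

theorem coeff_add (S T : L2 I ℂ →L[ℂ] L2 I ℂ) (i j : I) :
    coeff (S + T) i j = coeff S i j + coeff T i j := rfl

theorem coeff_smul (c : ℂ) (T : L2 I ℂ →L[ℂ] L2 I ℂ) (i j : I) :
    coeff (c • T) i j = c * coeff T i j := rfl

/-- The amplification `S ↦ S ⊗ 1` as a homomorphism. -/
def tensorOneHom (I H : Type*) [NormedAddCommGroup H] [InnerProductSpace ℂ H] [CompleteSpace H] :
    (L2 I ℂ →L[ℂ] L2 I ℂ) →⋆ₙₐ[ℂ] (L2 I H →L[ℂ] L2 I H) where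
  toFun S := tensorOne H S
  map_smul' c S := by
    refine entry_ext fun i j => ?_
    rw [entry_smul, entry_tensorOne, entry_tensorOne, coeff_smul, mul_smul]
    rfl
  map_zero' := by
    refine entry_ext fun i j => ?_
    rw [entry_tensorOne]
    exact (zero_smul ℂ _).trans (map_zero (entryLinear (H := H) i j)).symm
  map_add' S T := by
    refine entry_ext fun i j => ?_
    rw [entry_add, entry_tensorOne, entry_tensorOne, entry_tensorOne, coeff_add, add_smul]
  map_mul' S T := by
    rw [tensorOne_eq, tensorOne_eq, tensorOne_eq, tensorOp_mul, one_mul]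
  map_star' S := by
    rw [tensorOne_eq, tensorOne_eq, tensorOp_star, star_one]

theorem tensorOneHom_apply (S : L2 I ℂ →L[ℂ] L2 I ℂ) : tensorOneHom I H S = tensorOne H S := rfl

theorem tensorOne_mul (S T : L2 I ℂ →L[ℂ] L2 I ℂ) :
    tensorOne H (S * T) = tensorOne H S * tensorOne H T := map_mul (tensorOneHom I H) S T

theorem tensorOne_smul (c : ℂ) (S : L2 I ℂ →L[ℂ] L2 I ℂ) :
    tensorOne H (c • S) = c • tensorOne H S := map_smul (tensorOneHom I H) c S

theorem tensorOne_one : tensorOne H (1 : L2 I ℂ →L[ℂ] L2 I ℂ) = 1 := by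
  classical
  refine entry_ext fun i j => ?_
  have h : coeff (1 : L2 I ℂ →L[ℂ] L2 I ℂ) i j = if i = j then 1 else 0 := single_apply j i 1
  have h' := entry_oneTensor (I := I) (1 : H →L[ℂ] H) i j
  rw [map_one] at h'
  rw [entry_tensorOne, h, h']
  split_ifs <;> simp

/-- Since `tensorOp` is defined with the factors in the other order, this says that S ⊗ 1 and 1 ⊗ b
commute. -/
theorem oneTensor_mul_tensorOne (S : L2 I ℂ →L[ℂ] L2 I ℂ) (b : H →L[ℂ] H) :
    oneTensor (H := H) I b * tensorOne H S = tensorOp S b := by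
  have h : oneTensor (H := H) I b = tensorOp 1 b := by rw [tensorOp, tensorOne_one, one_mul]
  rw [h, tensorOne_eq, tensorOp_mul, one_mul, mul_one]

/-- `S ↦ S ⊗ b` as a linear map. -/
def tensorOpLeft (b : H →L[ℂ] H) : (L2 I ℂ →L[ℂ] L2 I ℂ) →ₗ[ℂ] (L2 I H →L[ℂ] L2 I H) where
  toFun S := tensorOp S b
  map_add' S T := by
    simp only [tensorOp, ← tensorOneHom_apply, map_add, add_mul]
  map_smul' c S := by
    simp only [tensorOp, ← tensorOneHom_apply, map_smul, smul_mul_assoc, RingHom.id_apply]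

theorem continuous_tensorOpLeft (b : H →L[ℂ] H) : Continuous (tensorOpLeft (I := I) b) :=
  AddMonoidHomClass.continuous_of_bound _ ‖b‖ fun S => by
    rw [mul_comm]; exact norm_tensorOp_le S b

end Entries

/-! ### The twisted translations and the closed spans they generate -/

section TwistedGroupAlgebra

variable {Γ H A : Type*} [Group Γ] [NormedAddCommGroup H] [InnerProductSpace ℂ H] [CompleteSpace H]
  [NonUnitalCStarAlgebra A]

theorem lam_mem_twistedGroupAlgebra (ω : TwoCocycle Γ) (g : Γ) :
    lam ω g ∈ twistedGroupAlgebra ω :=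
  NonUnitalStarSubalgebra.le_topologicalClosure _
    (NonUnitalStarAlgebra.subset_adjoin ℂ _ ⟨g, rfl⟩)

/-- Products and adjoints of the λ^{(ω)}_g are phases times other λ^{(ω)}_h, so their span is
already a *-algebra. -/
theorem mem_closedSpan_of_mem_twistedGroupAlgebra (ω : TwoCocycle Γ) {x : L2 Γ ℂ →L[ℂ] L2 Γ ℂ}
    (hx : x ∈ twistedGroupAlgebra ω) : x ∈ closedSpan (Set.range (lam ω)) := by
  refine topologicalClosure_adjoin_le_closedSpan ?_ ?_ (fun x hx => subset_closedSpan hx) hx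
  · rintro _ ⟨g, rfl⟩ _ ⟨h, rfl⟩
    rw [lam_mul]
    exact Submodule.smul_mem _ _ (Submodule.subset_span ⟨_, rfl⟩)
  · rintro _ ⟨g, rfl⟩
    rw [lam_star, Circle.smul_def]
    exact Submodule.smul_mem _ _ (Submodule.subset_span ⟨_, rfl⟩)

theorem mem_closedSpan_of_mem_minTensor (ω : TwoCocycle Γ) (π : A →⋆ₙₐ[ℂ] (H →L[ℂ] H))
    {T : L2 Γ H →L[ℂ] L2 Γ H}
    (hT : T ∈ minTensor (twistedGroupAlgebra ω) (NonUnitalStarAlgHom.range π)) :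
    T ∈ closedSpan {T : L2 Γ H →L[ℂ] L2 Γ H | ∃ g a, T = tensorOp (lam ω g) (π a)} := by
  have hT' : T ∈ (minTensor (twistedGroupAlgebra ω) (NonUnitalStarAlgHom.range π) : Set _) := hT
  rw [coe_minTensor] at hT'
  refine closedSpan_le (isClosed_closedSpan _) ?_ hT'
  rintro _ ⟨c, hc, _, ⟨a, rfl⟩, rfl⟩
  refine map_mem_of_mem_closedSpan (tensorOpLeft (π a)) (continuous_tensorOpLeft _)
    (isClosed_closedSpan _) ?_ (mem_closedSpan_of_mem_twistedGroupAlgebra ω hc)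
  rintro _ ⟨g, rfl⟩
  exact subset_closedSpan ⟨g, a, rfl⟩

/-- The cocycle identity at (g, g⁻¹, g) gives ω(g, g⁻¹) = ω(g⁻¹, g), so the phase in the adjoint
cancels the one in the product. -/
theorem star_lam_mul_lam (ω : TwoCocycle Γ) (g : Γ) : star (lam ω g) * lam ω g = 1 := by
  have h1 : lam ω 1 = 1 := by
    ext f k
    rw [lam_apply, ω.map_one_left]
    simp
  have hc := ω.cocycle g g⁻¹ g
  rw [mul_inv_cancel, ω.map_one_left, inv_mul_cancel, ω.map_one_right] at hc
  rw [lam_star, Circle.smul_def, smul_mul_assoc, lam_mul, smul_smul, ← Circle.coe_mul,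
    inv_mul_cancel, h1]
  have : ω.toFun g g⁻¹ = ω.toFun g⁻¹ g := by simpa using hc
  rw [this, inv_mul_cancel, Circle.coe_one, one_smul]

/-- The adjoint is a phase times λ^{(ω)}_{g⁻¹}; the cocycle identity at (g, g⁻¹, gt) collapses the
two phases into the single factor ω(g, t)⁻¹. -/
theorem tensorOne_star_lam_apply (ω : TwoCocycle Γ) (g t : Γ) (f : L2 Γ H) :
    tensorOne H (star (lam ω g)) f t = (((ω.toFun g t)⁻¹ : Circle) : ℂ) • f (g * t) := by
  rw [lam_star, Circle.smul_def, tensorOne_smul, tensorOne_eq]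
  change (((ω.toFun g g⁻¹)⁻¹ : Circle) : ℂ) • tensorOp (lam ω g⁻¹) (1 : H →L[ℂ] H) f t = _
  rw [tensorOp_lam_apply, smul_smul, ← Circle.coe_mul, inv_inv]
  have hc := ω.cocycle g g⁻¹ (g * t)
  rw [mul_inv_cancel, ω.map_one_left, inv_mul_cancel_left, mul_one] at hc
  rw [hc, mul_inv_rev, inv_mul_cancel_right]
  rfl

end TwistedGroupAlgebra

/-! ### Spectral subspaces of a coaction -/

section SpectralSubspaces

variable {Γ H A : Type*} [Group Γ] [NormedAddCommGroup H] [InnerProductSpace ℂ H] [CompleteSpace H]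
  [NonUnitalCStarAlgebra A] {π : A →⋆ₙₐ[ℂ] (H →L[ℂ] H)} {hπ : Function.Injective π}

theorem one_eq_tensorOp_lam (b : H →L[ℂ] H) (ω : TwoCocycle Γ) :
    oneTensor (H := H) Γ b = tensorOp (lam ω 1) b := by
  ext f h
  rw [tensorOp_lam_apply, ω.map_one_left, Circle.coe_one, one_smul, inv_one, one_mul]
  rfl

/-- The entries of an element of `C*_r(Γ) ⊗ A` are constant along `(i, j) ↦ i j⁻¹`. -/
theorem entry_mul_left_of_mem_minTensor {T : L2 Γ H →L[ℂ] L2 Γ H}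
    (hT : T ∈ minTensor (reducedGroupAlgebra Γ) (NonUnitalStarAlgHom.range π)) (g j : Γ) :
    entry T (g * j) j = entry T g 1 := by
  classical
  let L : (L2 Γ H →L[ℂ] L2 Γ H) →ₗ[ℂ] (H →L[ℂ] H) :=
    entryLinear (g * j) j - entryLinear g 1
  have hL : Continuous L := (continuous_entryLinear (g * j) j).sub (continuous_entryLinear g 1)
  have key : L T ∈ (⊥ : Submodule ℂ (H →L[ℂ] H)) := by
    refine map_mem_of_mem_closedSpan L hL isClosed_singleton ?_
      (mem_closedSpan_of_mem_minTensor _ π hT)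
    rintro _ ⟨k, a, rfl⟩
    rw [Submodule.mem_bot]
    change entry (tensorOp (lam _ k) (π a)) (g * j) j - entry (tensorOp (lam _ k) (π a)) g 1 = 0
    -- For the trivial cocycle both coefficients are 1 when g = k and 0 otherwise.
    rw [entry_tensorOp, entry_tensorOp, coeff_lam, coeff_lam, mul_left_inj, mul_one, sub_eq_zero]
    rfl
  exact sub_eq_zero.1 ((Submodule.mem_bot ℂ).1 key)

namespace Coaction

variable (α : Coaction Γ π hπ)

/-- The spectral subspace `{a | α(a) = λ_g ⊗ a}`. -/
def spectral (g : Γ) : Set A :=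
  {a | α.toHom a = tensorOp (lam (TwoCocycle.trivial Γ) g) (π a)}

/-- The projection `E_g` of `A` onto the spectral subspace of `g`, i.e. the slice of `α(a)` by
`⟨δ_g, · δ_e⟩`. -/
def fourier (g : Γ) (a : A) : A :=
  (exists_entry_of_mem_minTensor (reducedGroupAlgebra Γ) π hπ (α.mem a) g 1).choose

theorem map_fourier (g : Γ) (a : A) : π (α.fourier g a) = entry (α.toHom a) g 1 :=
  (exists_entry_of_mem_minTensor (reducedGroupAlgebra Γ) π hπ (α.mem a) g 1).choose_spec

/-- Formally α(a) = ∑ λ_g ⊗ E_g(a): the matrix of α(a) is constant along i j⁻¹, so its first column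
determines it. -/
theorem entry_toHom (a : A) (i j : Γ) : entry (α.toHom a) i j = π (α.fourier (i * j⁻¹) a) := by
  rw [map_fourier, ← entry_mul_left_of_mem_minTensor (α.mem a) (i * j⁻¹) j, inv_mul_cancel_right]

/-- Compare the (g, e) entries in the coassociativity identity: that of (ι ⊗ α)α(a) is α(E_g(a)),
while that of (δ ⊗ ι)α(a) is λ_g ⊗ E_g(a). -/
theorem fourier_mem_spectral (g : Γ) (a : A) : α.fourier g a ∈ α.spectral g := by
  have h1 : entry (deltaL Γ H (α.toHom a)) g 1 = α.toHom (α.fourier g a) := by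
    rw [← α.coassoc a]
    exact entry_idTensorFun (reducedGroupAlgebra Γ) π hπ α.toHom ⟨α.toHom a, α.mem a⟩
      (α.map_fourier g a)
  change α.toHom (α.fourier g a) = _
  rw [← h1]
  ext η h
  rw [tensorOp_lam_apply]
  change α.toHom a ((shear Γ H).symm (single 1 η) (h⁻¹ * g)) h = ((1 : Circle) : ℂ) • _
  -- At this outer index only the inner coordinate g⁻¹h survives, so α(a) is probed at the entry (h,
  -- g⁻¹h), which is E_g(a).
  have h2 : (shear Γ H).symm (single 1 η) (h⁻¹ * g) = single (g⁻¹ * h) (η (g⁻¹ * h)) := by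
    ext k
    change (single (1 : Γ) η : L2 Γ (L2 Γ H)) (k * (h⁻¹ * g)) k = _
    by_cases hk : k = g⁻¹ * h
    · subst hk
      rw [single_apply_self, show g⁻¹ * h * (h⁻¹ * g) = 1 by group, single_apply_self]
    · rw [single_apply_ne hk, single_apply_ne]
      · rfl
      · intro h'
        exact hk (by rw [eq_inv_of_mul_eq_one_left h']; group)
  rw [h2, ← entry_apply, entry_toHom, Circle.coe_one, one_smul]
  congr 3
  group

theorem mul_mem_spectral {g h : Γ} {a b : A} (ha : a ∈ α.spectral g) (hb : b ∈ α.spectral h) :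
    a * b ∈ α.spectral (g * h) := by
  change α.toHom (a * b) = _
  rw [map_mul, map_mul, show α.toHom a = _ from ha, show α.toHom b = _ from hb, tensorOp_mul,
    lam_mul]
  congr 1
  exact one_smul ℂ _

theorem star_mem_spectral {g : Γ} {a : A} (ha : a ∈ α.spectral g) :
    star a ∈ α.spectral g⁻¹ := by
  change α.toHom (star a) = _
  rw [map_star, map_star, show α.toHom a = _ from ha, tensorOp_star, lam_star]
  congr 1
  change ((1 : Circle)⁻¹) • _ = _
  rw [inv_one, one_smul]

/-- The spectral subspaces span a dense subspace of `A`. -/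
theorem mem_closedSpan_spectral (b : A) : b ∈ closedSpan (⋃ g, α.spectral g) := by
  have hiso := NonUnitalStarAlgHom.isometry π hπ
  have hπc : Continuous (π : A →ₗ[ℂ] (H →L[ℂ] H)) := hiso.continuous
  set p : Submodule ℂ (H →L[ℂ] H) :=
    (closedSpan (⋃ g, α.spectral g)).map (π : A →ₗ[ℂ] (H →L[ℂ] H)) with hp
  -- A faithful representation is isometric, so it maps closed subspaces to closed ones.
  have hpc : IsClosed (p : Set (H →L[ℂ] H)) := by
    rw [hp, Submodule.map_coe]
    exact hiso.isClosedEmbedding.isClosedMap _ (isClosed_closedSpan _)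
  -- The operator 1 ⊗ b = λ_e ⊗ b is approximated by sums of (c ⊗ 1)α(a) by the cancellation
  -- condition; its (e, e) entry then recovers b.
  have h1 : tensorOp (lam (TwoCocycle.trivial Γ) 1) (π b) ∈
      closedSpan {T | ∃ c ∈ reducedGroupAlgebra Γ, ∃ a, T = tensorOne H c * α.toHom a} := by
    rw [← SetLike.mem_coe, coe_closedSpan, α.cancellation]
    exact tensorOp_mem_minTensor _ π (lam_mem_twistedGroupAlgebra _ 1) b
  have h2 := map_mem_of_mem_closedSpan (entryLinear (H := H) (1 : Γ) 1)
    (continuous_entryLinear _ _) hpc ?_ h1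
  · obtain ⟨a, ha, hab⟩ := h2
    have : entryLinear (H := H) (1 : Γ) 1 (tensorOp (lam (TwoCocycle.trivial Γ) 1) (π b)) = π b := by
      change entry _ _ _ = _
      rw [entry_tensorOp, coeff_lam, if_pos (by simp)]
      exact one_smul ℂ _
    rw [this] at hab
    exact hπ hab ▸ ha
  · rintro _ ⟨c, hc, a, rfl⟩
    let L : (L2 Γ ℂ →L[ℂ] L2 Γ ℂ) →ₗ[ℂ] (L2 Γ H →L[ℂ] L2 Γ H) :=
      (LinearMap.mulRight ℂ (α.toHom a)).comp (tensorOneHom Γ H : _ →ₗ[ℂ] _)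
    have hL : Continuous L :=
      (continuous_mul_const (α.toHom a)).comp (map_continuous (tensorOneHom Γ H))
    refine map_mem_of_mem_closedSpan ((entryLinear (H := H) (1 : Γ) 1).comp L)
      ((continuous_entryLinear _ _).comp hL) hpc ?_
      (mem_closedSpan_of_mem_twistedGroupAlgebra _ hc)
    rintro _ ⟨g, rfl⟩
    -- Multiplication by λ_g ⊗ 1 shifts rows by g, so the (e, e) entry of (λ_g ⊗ 1)α(a) is the (g⁻¹,
    -- e) entry of α(a).
    refine ⟨α.fourier g⁻¹ a, subset_closedSpan (Set.mem_iUnion.2 ⟨_, α.fourier_mem_spectral _ _⟩),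
      ?_⟩
    change π (α.fourier g⁻¹ a) = entry (tensorOne H (lam _ g) * α.toHom a) 1 1
    rw [map_fourier]
    ext x
    rw [tensorOne_eq]
    change _ = tensorOp (lam (TwoCocycle.trivial Γ) g) 1 (α.toHom a (single 1 x)) 1
    rw [tensorOp_lam_apply, mul_one]
    exact (one_smul ℂ _).symm

end Coaction

end SpectralSubspaces

/-! ### A'_ω as a closed span -/

section Alt

variable {Γ H A : Type*} [Group Γ] [NormedAddCommGroup H] [InnerProductSpace ℂ H] [CompleteSpace H]
  [NonUnitalCStarAlgebra A] {π : A →⋆ₙₐ[ℂ] (H →L[ℂ] H)} {hπ : Function.Injective π}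

theorem continuous_conjHom {K : Type*} [NormedAddCommGroup K] [InnerProductSpace ℂ K]
    [CompleteSpace K] (U : H ≃ₗᵢ[ℂ] K) : Continuous (conjHom U) := map_continuous _

variable (α : Coaction Γ π hπ) (ω : TwoCocycle Γ)

/-- The elements `λ^{(ω)}_g ⊗ a`, with `a` in the spectral subspace of `g`. -/
def altGenerators : Set (L2 Γ H →L[ℂ] L2 Γ H) :=
  {T | ∃ g, ∃ a ∈ α.spectral g, T = tensorOp (lam ω g) (π a)}

/-- The algebra `A'_ω` contains the closed span of the `λ^{(ω)}_g ⊗ a`. -/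
theorem mem_deformationAlt_of_mem_closedSpan {x : L2 Γ H →L[ℂ] L2 Γ H}
    (hx : x ∈ closedSpan (altGenerators α ω)) : x ∈ deformationAlt α ω := by
  -- The defining equation makes sense only on the minimal tensor product: its solution set is
  -- closed there, and the tensor product is closed in the bounded operators.
  have hclosed : IsClosed ((deformationAlt α ω).toSubmodule : Set (L2 Γ H →L[ℂ] L2 Γ H)) := by
    set M := minTensor (twistedGroupAlgebra ω) (NonUnitalStarAlgHom.range π) with hM
    have h1 : IsClosed {x : M | conjHom (flip (I := Γ) (J := Γ) (H := H))
        (idTensor (twistedGroupAlgebra ω) π hπ α.toHom x) = deltaL Γ H x.1} :=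
      isClosed_eq ((continuous_conjHom _).comp (continuous_idTensorLinear _ π hπ α.toHom))
        ((map_continuous (deltaL Γ H)).comp continuous_subtype_val)
    have hMc : IsClosed (M : Set (L2 Γ H →L[ℂ] L2 Γ H)) :=
      NonUnitalStarSubalgebra.isClosed_topologicalClosure _
    convert hMc.isClosedEmbedding_subtypeVal.isClosedMap _ h1
    ext x
    constructor
    · rintro ⟨hx, h⟩
      exact ⟨⟨x, hx⟩, h, rfl⟩
    · rintro ⟨⟨x, hx⟩, h, rfl⟩
      exact ⟨hx, h⟩
  refine closedSpan_le hclosed ?_ hx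
  rintro _ ⟨g, a, ha, rfl⟩
  refine ⟨tensorOp_mem_minTensor _ π (lam_mem_twistedGroupAlgebra ω g) a, ?_⟩
  rw [idTensor_tensorOp _ π hπ α.toHom (lam_mem_twistedGroupAlgebra ω g) a, deltaL_tensorOp,
    show α.toHom a = _ from ha]
  -- For a in A_g both sides are λ_g ⊗ λ^{(ω)}_g ⊗ a; it remains to compare coordinates.
  ext f s t
  rw [conjHom_apply, flip_apply, tensorOp_lam_apply, tensorOp_lam_apply]
  change (ω.toFun g (g⁻¹ * t) : ℂ) • tensorOp (lam (TwoCocycle.trivial Γ) g) (π a) _ s =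
    ((1 : Circle) : ℂ) • tensorOp (lam ω g) (π a) _ t
  rw [tensorOp_lam_apply, tensorOp_lam_apply, smul_comm]
  rfl

/-- The algebra `A'_ω` is contained in the closed span of the `λ^{(ω)}_g ⊗ a`. -/
theorem mem_closedSpan_of_mem_deformationAlt {x : L2 Γ H →L[ℂ] L2 Γ H}
    (hx : x ∈ deformationAlt α ω) : x ∈ closedSpan (altGenerators α ω) := by
  obtain ⟨hx, hfix⟩ := hx
  set C := twistedGroupAlgebra ω with hC
  -- Φ undoes the shear that implements δ_l ⊗ ι and then takes the (e, e) entry. On A'_ω it is the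
  -- identity, since there (ι ⊗ α)(x)_{213} is the sheared 1 ⊗ x; on elementary tensors it sends
  -- λ^{(ω)}_g ⊗ a to λ^{(ω)}_g ⊗ E_g(a).
  let Φ : minTensor C (NonUnitalStarAlgHom.range π) →ₗ[ℂ] (L2 Γ H →L[ℂ] L2 Γ H) :=
    (entryLinear (H := L2 Γ H) (1 : Γ) 1).comp
      (((conjHom (shear Γ H).symm).comp
        (conjHom (flip (I := Γ) (J := Γ) (H := H)))).toAlgHom.toLinearMap.comp
        (idTensorLinear C π hπ α.toHom))
  have hΦ : Continuous Φ := (continuous_entryLinear _ _).comp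
    (((continuous_conjHom _).comp (continuous_conjHom _)).comp (continuous_idTensorLinear _ _ _ _))
  have hΦx : Φ ⟨x, hx⟩ = x := by
    change entry (conjHom (shear Γ H).symm (conjHom (flip (I := Γ) (J := Γ) (H := H))
      (idTensor C π hπ α.toHom ⟨x, hx⟩))) 1 1 = x
    rw [hfix]
    ext η h
    change ((shear Γ H).symm (shear Γ H (oneTensor (H := L2 Γ H) Γ x
      ((shear Γ H).symm ((shear Γ H) (single 1 η)))))) 1 h = x η h
    rw [LinearIsometryEquiv.symm_apply_apply, LinearIsometryEquiv.symm_apply_apply,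
      oneTensor_apply, single_apply_self]
  rw [← hΦx]
  -- Φ lives on the tensor product as a subtype, so density of the span is transferred from the
  -- ambient operators to the subtype.
  have hmem : (⟨x, hx⟩ : minTensor C (NonUnitalStarAlgHom.range π)) ∈
      closedSpan {T : minTensor C (NonUnitalStarAlgHom.range π) |
        ∃ g a, T.1 = tensorOp (lam ω g) (π a)} := by
    have himage : Subtype.val '' {T : minTensor C (NonUnitalStarAlgHom.range π) |
        ∃ g a, T.1 = tensorOp (lam ω g) (π a)} =
        {T : L2 Γ H →L[ℂ] L2 Γ H | ∃ g a, T = tensorOp (lam ω g) (π a)} := by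
      ext T
      constructor
      · rintro ⟨T, hT, rfl⟩; exact hT
      · rintro ⟨g, a, rfl⟩
        exact ⟨⟨_, tensorOp_mem_minTensor C π (lam_mem_twistedGroupAlgebra ω g) a⟩, ⟨g, a, rfl⟩, rfl⟩
    have hspan : Subtype.val '' (Submodule.span ℂ {T : minTensor C (NonUnitalStarAlgHom.range π) |
        ∃ g a, T.1 = tensorOp (lam ω g) (π a)} : Set (minTensor C (NonUnitalStarAlgHom.range π))) =
        (Submodule.span ℂ {T : L2 Γ H →L[ℂ] L2 Γ H | ∃ g a, T = tensorOp (lam ω g) (π a)} :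
          Submodule ℂ _) := by
      rw [← himage]
      exact congrArg (fun S : Submodule ℂ (L2 Γ H →L[ℂ] L2 Γ H) => (S : Set (L2 Γ H →L[ℂ] L2 Γ H)))
        (Submodule.map_span (minTensor C (NonUnitalStarAlgHom.range π)).toSubmodule.subtype _)
    rw [← SetLike.mem_coe, coe_closedSpan, closure_subtype, hspan]
    exact mem_closedSpan_of_mem_minTensor ω π hx
  refine map_mem_of_mem_closedSpan Φ hΦ (isClosed_closedSpan _) ?_ hmem
  rintro ⟨_, hT⟩ ⟨g, a, rfl⟩
  refine subset_closedSpan ⟨g, α.fourier g a, α.fourier_mem_spectral g a, ?_⟩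
  change entry (conjHom (shear Γ H).symm (conjHom (flip (I := Γ) (J := Γ) (H := H))
      (idTensor C π hπ α.toHom ⟨tensorOp (lam ω g) (π a), hT⟩))) 1 1 = _
  rw [idTensor_tensorOp C π hπ α.toHom (lam_mem_twistedGroupAlgebra ω g) a]
  ext η h
  rw [tensorOp_lam_apply]
  change tensorOp (lam ω g) (α.toHom a) (flip.symm (shear Γ H (single 1 η))) h (h * 1) = _
  rw [mul_one, tensorOp_lam_apply]
  -- The vector is concentrated at g⁻¹h, so only the entry (h, g⁻¹h) of α(a) contributes, and this
  -- is E_g(a).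
  have h3 : (flip (I := Γ) (J := Γ) (H := H)).symm (shear Γ H (single 1 η)) (g⁻¹ * h) =
      single (g⁻¹ * h) (η (g⁻¹ * h)) := by
    ext l
    change (single (1 : Γ) η : L2 Γ (L2 Γ H)) ((g⁻¹ * h)⁻¹ * l) (g⁻¹ * h) = _
    by_cases hl : l = g⁻¹ * h
    · subst hl
      rw [inv_mul_cancel, single_apply_self, single_apply_self]
    · rw [single_apply_ne hl, single_apply_ne]
      · rfl
      · intro h'
        exact hl (inv_mul_eq_one.1 h').symm
  rw [h3]
  change (ω.toFun g (g⁻¹ * h) : ℂ) • (entry (α.toHom a) h (g⁻¹ * h)) (η (g⁻¹ * h)) = _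
  rw [Coaction.entry_toHom]
  congr 4
  group

end Alt

/-! ### The braided tensor product and its fixed point algebra -/

section Braided

variable {Γ H A : Type*} [Group Γ] [NormedAddCommGroup H] [InnerProductSpace ℂ H] [CompleteSpace H]
  [NonUnitalCStarAlgebra A] {π : A →⋆ₙₐ[ℂ] (H →L[ℂ] H)} {hπ : Function.Injective π}

theorem adTilde_apply (ω : TwoCocycle Γ) (x : L2 Γ ℂ →L[ℂ] L2 Γ ℂ) (f : L2 Γ (L2 Γ H)) (s : Γ) :
    adTilde H ω x f s = tensorOne H (lam ω s⁻¹ * x * star (lam ω s⁻¹)) (f s) := rfl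

theorem star_diagOp {I : Type*} (b c : I → H →L[ℂ] H) (hb : BddAbove (Set.range fun i => ‖b i‖))
    (hc : BddAbove (Set.range fun i => ‖c i‖)) (h : ∀ i, c i = star (b i)) :
    diagOp c hc = star (diagOp b hb) := by
  classical
  refine entry_ext fun i j => ?_
  rw [entry_star, entry_diagOp, entry_diagOp]
  by_cases hij : i = j
  · subst hij
    rw [if_pos rfl, if_pos rfl, h]
  · rw [if_neg hij, if_neg (Ne.symm hij), star_zero]

theorem adTilde_star (ω : TwoCocycle Γ) (x : L2 Γ ℂ →L[ℂ] L2 Γ ℂ) :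
    adTilde H ω (star x) = star (adTilde H ω x) := by
  refine star_diagOp (H := L2 Γ H) _ _ (bddAbove_ad ω x) (bddAbove_ad ω (star x)) fun i => ?_
  have e : lam ω i⁻¹ * star x * star (lam ω i⁻¹) =
      star (lam ω i⁻¹ * x * star (lam ω i⁻¹)) := by
    simp only [star_mul, star_star, mul_assoc]
  rw [e]
  exact map_star (tensorOneHom Γ H) _

/-- The map `x ↦ \widetilde{Ad}(x)_{13}` as a homomorphism. -/
def adTildeHom (H : Type*) [NormedAddCommGroup H] [InnerProductSpace ℂ H] [CompleteSpace H]
    (ω : TwoCocycle Γ) :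
    (L2 Γ ℂ →L[ℂ] L2 Γ ℂ) →⋆ₙₐ[ℂ] (L2 Γ (L2 Γ H) →L[ℂ] L2 Γ (L2 Γ H)) where
  toFun x := adTilde H ω x
  map_smul' c x := by
    ext f s : 3
    rw [adTilde_apply, mul_smul_comm, smul_mul_assoc, tensorOne_smul]
    rfl
  map_zero' := by
    ext f s : 3
    rw [adTilde_apply, mul_zero, zero_mul, ← tensorOneHom_apply, map_zero]
    rfl
  map_add' x y := by
    ext f s : 3
    rw [adTilde_apply, mul_add, add_mul, ← tensorOneHom_apply, map_add]
    rfl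
  map_mul' x y := by
    ext f s : 3
    have h : lam ω s⁻¹ * (x * y) * star (lam ω s⁻¹) =
        (lam ω s⁻¹ * x * star (lam ω s⁻¹)) * (lam ω s⁻¹ * y * star (lam ω s⁻¹)) := by
      -- Conjugation by a unitary is multiplicative: the middle 1 is replaced by (λ_{s⁻¹})* λ_{s⁻¹}.
      calc _ = lam ω s⁻¹ * x * 1 * y * star (lam ω s⁻¹) := by simp only [mul_assoc, one_mul]
        _ = _ := by rw [← star_lam_mul_lam ω s⁻¹]; simp only [mul_assoc]
    rw [adTilde_apply, h, tensorOne_mul]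
    rfl
  map_star' x := adTilde_star ω x

theorem adTildeHom_apply (ω : TwoCocycle Γ) (x : L2 Γ ℂ →L[ℂ] L2 Γ ℂ) :
    adTildeHom H ω x = adTilde H ω x := rfl

theorem adTilde_mul (ω : TwoCocycle Γ) (x y : L2 Γ ℂ →L[ℂ] L2 Γ ℂ) :
    adTilde H ω (x * y) = adTilde H ω x * adTilde H ω y := map_mul (adTildeHom H ω) x y

/-- The map `T ↦ T_{12}` as a homomorphism. -/
def leg12Hom (Γ H : Type*) [Group Γ] [NormedAddCommGroup H] [InnerProductSpace ℂ H] [CompleteSpace H] :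
    (L2 Γ H →L[ℂ] L2 Γ H) →⋆ₐ[ℂ] (L2 Γ (L2 Γ H) →L[ℂ] L2 Γ (L2 Γ H)) :=
  conjAmp (flip (I := Γ) (J := Γ) (H := H))

theorem leg12Hom_apply (T : L2 Γ H →L[ℂ] L2 Γ H) : leg12Hom Γ H T = leg12 T := rfl

theorem leg12_mul (S T : L2 Γ H →L[ℂ] L2 Γ H) : leg12 (S * T) = leg12 S * leg12 T :=
  map_mul (leg12Hom Γ H) S T

theorem leg12_tensorOp_apply (k : Γ) (b : H →L[ℂ] H) (f : L2 Γ (L2 Γ H)) (s : Γ) :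
    leg12 (tensorOp (lam (TwoCocycle.trivial Γ) k) b) f s =
      oneTensor (H := H) Γ b (f (k⁻¹ * s)) := by
  ext t
  change tensorOp (lam (TwoCocycle.trivial Γ) k) b _ s = _
  rw [tensorOp_lam_apply]
  exact one_smul ℂ _

/-- The commutation relation between the two kinds of generators of the braided tensor product. -/
theorem adTilde_mul_leg12 (ω : TwoCocycle Γ) (x : L2 Γ ℂ →L[ℂ] L2 Γ ℂ) (k : Γ) (b : H →L[ℂ] H) :
    adTilde H ω x * leg12 (tensorOp (lam (TwoCocycle.trivial Γ) k) b) =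
      leg12 (tensorOp (lam (TwoCocycle.trivial Γ) k) b) *
        adTilde H ω (lam ω k⁻¹ * x * star (lam ω k⁻¹)) := by
  ext f s : 3
  change adTilde H ω x (leg12 (tensorOp (lam (TwoCocycle.trivial Γ) k) b) f) s =
    leg12 (tensorOp (lam (TwoCocycle.trivial Γ) k) b) (adTilde H ω _ f) s
  rw [leg12_tensorOp_apply, adTilde_apply, adTilde_apply, leg12_tensorOp_apply]
  -- The leg-12 factor moves the first index from s to k⁻¹s. Conjugation by λ_{k⁻¹} followed by
  -- λ_{s⁻¹k} is conjugation by λ_{s⁻¹}, because the phase in their product cancels against its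
  -- conjugate.
  have h : lam ω (k⁻¹ * s)⁻¹ * (lam ω k⁻¹ * x * star (lam ω k⁻¹)) * star (lam ω (k⁻¹ * s)⁻¹) =
      lam ω s⁻¹ * x * star (lam ω s⁻¹) := by
    have h1 := lam_mul ω (s⁻¹ * k) k⁻¹
    rw [mul_inv_cancel_right] at h1
    calc _ = (lam ω (s⁻¹ * k) * lam ω k⁻¹) * x * star (lam ω (s⁻¹ * k) * lam ω k⁻¹) := by
          rw [mul_inv_rev, inv_inv, star_mul]; simp only [mul_assoc]
      _ = _ := by
          rw [h1, star_smul, smul_mul_assoc, smul_mul_assoc, mul_smul_comm, smul_smul]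
          rw [RCLike.star_def, ← Circle.coe_inv_eq_conj, ← Circle.coe_mul, mul_inv_cancel,
            Circle.coe_one, one_smul]
  rw [h]
  exact DFunLike.congr_fun (oneTensor_mul_tensorOne (lam ω s⁻¹ * x * star (lam ω s⁻¹)) b).symm
    (f (k⁻¹ * s))

variable (α : Coaction Γ π hπ) (ω : TwoCocycle Γ)

/-- The elements `α(a)_{12} \widetilde{Ad}(λ^{(ω)}_g)_{13}`, with `a` in a spectral subspace. -/
def braidedGenerators : Set (L2 Γ (L2 Γ H) →L[ℂ] L2 Γ (L2 Γ H)) :=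
  {T | ∃ h, ∃ a ∈ α.spectral h, ∃ g, T = leg12 (α.toHom a) * adTilde H ω (lam ω g)}

variable {α} in
theorem leg12_mul_adTilde_mem_span {h : Γ} {a : A} (ha : a ∈ α.spectral h) {z : ℂ}
    {x : L2 Γ ℂ →L[ℂ] L2 Γ ℂ} {g : Γ} (hx : x = z • lam ω g) :
    leg12 (α.toHom a) * adTilde H ω x ∈ Submodule.span ℂ (braidedGenerators α ω) := by
  rw [hx, ← adTildeHom_apply, map_smul, mul_smul_comm]
  exact Submodule.smul_mem _ _ (Submodule.subset_span ⟨h, a, ha, g, rfl⟩)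

/-- By the commutation relation, moving the Ad-tilde of λ_g past a leg-12 factor of degree k
replaces λ_g by a scalar multiple of λ_{k⁻¹gk}. Hence the span of the homogeneous products is stable
under products and adjoints. -/
theorem mem_closedSpan_of_mem_braidedTensor {T : L2 Γ (L2 Γ H) →L[ℂ] L2 Γ (L2 Γ H)}
    (hT : T ∈ braidedTensor α ω) : T ∈ closedSpan (braidedGenerators α ω) := by
  refine topologicalClosure_adjoin_le_closedSpan ?_ ?_ ?_ hT
  · rintro _ ⟨h, a, ha, g, rfl⟩ _ ⟨k, b, hb, l, rfl⟩
    obtain ⟨z, hz⟩ := exists_ad_lam ω k⁻¹ g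
    have e : leg12 (α.toHom a) * adTilde H ω (lam ω g) *
        (leg12 (α.toHom b) * adTilde H ω (lam ω l)) =
        leg12 (α.toHom (a * b)) * adTilde H ω
          (lam ω k⁻¹ * lam ω g * star (lam ω k⁻¹) * lam ω l) := by
      have h1 := adTilde_mul_leg12 ω (lam ω g) k (π b)
      rw [← show α.toHom b = _ from hb] at h1
      rw [adTilde_mul, map_mul, leg12_mul, mul_assoc, ← mul_assoc (adTilde H ω (lam ω g)), h1]
      simp only [mul_assoc]
    rw [e]
    refine leg12_mul_adTilde_mem_span ω (α.mul_mem_spectral ha hb)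
      (z := z * (ω.toFun (k⁻¹ * g * k⁻¹⁻¹) l : ℂ)) (g := k⁻¹ * g * k⁻¹⁻¹ * l) ?_
    rw [hz, smul_mul_assoc, lam_mul, smul_smul]
  · rintro _ ⟨h, a, ha, g, rfl⟩
    have ha' := α.star_mem_spectral ha
    obtain ⟨z, hz⟩ := exists_ad_lam ω h⁻¹⁻¹ g⁻¹
    have h1 := adTilde_mul_leg12 ω (star (lam ω g)) h⁻¹ (π (star a))
    rw [← show α.toHom (star a) = _ from ha'] at h1
    have e : star (leg12 (α.toHom a) * adTilde H ω (lam ω g)) =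
        adTilde H ω (star (lam ω g)) * leg12 (α.toHom (star a)) := by
      rw [star_mul, adTilde_star, ← leg12Hom_apply, ← leg12Hom_apply, map_star α.toHom,
        map_star (leg12Hom Γ H)]
    rw [e, h1]
    refine leg12_mul_adTilde_mem_span ω ha'
      (z := (((ω.toFun g g⁻¹)⁻¹ : Circle) : ℂ) * z) (g := h⁻¹⁻¹ * g⁻¹ * h⁻¹⁻¹⁻¹) ?_
    rw [lam_star, Circle.smul_def, mul_smul_comm, smul_mul_assoc, hz, smul_smul]
  · rintro _ ⟨a, x, hx, rfl⟩
    -- Two reductions by continuity: `L` replaces x by some λ_g, then `R` replaces a by a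
    -- homogeneous element.
    let L : (L2 Γ ℂ →L[ℂ] L2 Γ ℂ) →ₗ[ℂ] (L2 Γ (L2 Γ H) →L[ℂ] L2 Γ (L2 Γ H)) :=
      (LinearMap.mulLeft ℂ (leg12 (α.toHom a))).comp (adTildeHom H ω : _ →ₗ[ℂ] _)
    have hL : Continuous L :=
      (continuous_const_mul (leg12 (α.toHom a))).comp (map_continuous (adTildeHom H ω))
    refine map_mem_of_mem_closedSpan L hL (isClosed_closedSpan _) ?_
      (mem_closedSpan_of_mem_twistedGroupAlgebra ω hx)
    rintro _ ⟨g, rfl⟩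
    let R : A →ₗ[ℂ] (L2 Γ (L2 Γ H) →L[ℂ] L2 Γ (L2 Γ H)) :=
      (LinearMap.mulRight ℂ (adTilde H ω (lam ω g))).comp
        ((leg12Hom Γ H).toAlgHom.toLinearMap.comp (α.toHom : _ →ₗ[ℂ] _))
    have hR : Continuous R := (continuous_mul_const (adTilde H ω (lam ω g))).comp
      ((map_continuous (leg12Hom Γ H)).comp (AddMonoidHomClass.continuous_of_bound α.toHom 1
        fun a => by rw [one_mul]; exact NonUnitalStarAlgHom.norm_apply_le α.toHom a))
    refine map_mem_of_mem_closedSpan R hR (isClosed_closedSpan _) ?_ (α.mem_closedSpan_spectral a)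
    intro b hb
    obtain ⟨h, hb⟩ := Set.mem_iUnion.1 hb
    exact subset_closedSpan ⟨h, b, hb, g, rfl⟩

/-- The product is homogeneous of degree hg for the diagonal coaction: the leg-12 factor has degree
h because δ(λ_h) = λ_h ⊗ λ_h, and the Ad-tilde factor has degree g. -/
theorem diagonalCoaction_generator {h : Γ} {a : A} (ha : a ∈ α.spectral h) (g : Γ) :
    diagonalCoaction Γ H (leg12 (α.toHom a) * adTilde H ω (lam ω g)) =
      tensorOp (lam (TwoCocycle.trivial Γ) (h * g))
        (leg12 (α.toHom a) * adTilde H ω (lam ω g)) := by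
  have h1 : diagonalCoaction Γ H (leg12 (α.toHom a)) =
      tensorOp (lam (TwoCocycle.trivial Γ) h) (leg12 (α.toHom a)) := by
    rw [diagonalCoaction_leg12, show α.toHom a = _ from ha, deltaL_tensorOp]
    ext f s k t
    rw [tensorOp_lam_apply]
    change tensorOp (lam (TwoCocycle.trivial Γ) h)
      (tensorOp (lam (TwoCocycle.trivial Γ) h) (π a)) _ s k = ((1 : Circle) : ℂ) •
        leg12 (tensorOp (lam (TwoCocycle.trivial Γ) h) (π a)) (f (h⁻¹ * s)) k t
    rw [leg12_tensorOp_apply, tensorOp_lam_apply]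
    change ((1 : Circle) : ℂ) • tensorOp (lam (TwoCocycle.trivial Γ) h) (π a) _ k = _
    rw [tensorOp_lam_apply]
    change ((1 : Circle) : ℂ) • ((1 : Circle) : ℂ) • π a (f (h⁻¹ * s) (h⁻¹ * k) t) = _
    simp only [Circle.coe_one, one_smul]
    rfl
  rw [map_mul, h1, diagonalCoaction_adTilde, tensorOp_mul, lam_mul]
  congr 1
  exact one_smul ℂ _

/-- The elements `α(a)_{12} \widetilde{Ad}(λ^{(\bar ω)}_{g⁻¹})_{13}`, with `a` in the spectral
subspace of `g`. -/
def fixedGenerators : Set (L2 Γ (L2 Γ H) →L[ℂ] L2 Γ (L2 Γ H)) :=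
  {T | ∃ g, ∃ a ∈ α.spectral g, T = leg12 (α.toHom a) * adTilde H ω.conj (lam ω.conj g⁻¹)}

/-- The (e, e) entry of the diagonal coaction is the projection onto degree e. It fixes T, and it
keeps a homogeneous product of degree hg when hg = e and kills it otherwise. -/
theorem mem_closedSpan_of_mem_deformation {T : L2 Γ (L2 Γ H) →L[ℂ] L2 Γ (L2 Γ H)}
    (hT : T ∈ deformation α ω) : T ∈ closedSpan (fixedGenerators α ω) := by
  classical
  obtain ⟨hT, hfix⟩ := hT
  let Ψ : (L2 Γ (L2 Γ H) →L[ℂ] L2 Γ (L2 Γ H)) →ₗ[ℂ] (L2 Γ (L2 Γ H) →L[ℂ] L2 Γ (L2 Γ H)) :=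
    (entryLinear (1 : Γ) 1).comp (diagonalCoaction Γ H).toAlgHom.toLinearMap
  have hΨ : Continuous Ψ :=
    (continuous_entryLinear _ _).comp (map_continuous (diagonalCoaction Γ H))
  have hΨT : Ψ T = T := by
    change entry (diagonalCoaction Γ H T) 1 1 = T
    rw [hfix, entry_oneTensor, if_pos rfl]
  rw [← hΨT]
  refine map_mem_of_mem_closedSpan Ψ hΨ (isClosed_closedSpan _) ?_
    (mem_closedSpan_of_mem_braidedTensor α ω.conj hT)
  rintro _ ⟨h, a, ha, g, rfl⟩
  change entry (diagonalCoaction Γ H _) 1 1 ∈ _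
  rw [diagonalCoaction_generator α ω.conj ha, entry_tensorOp, coeff_lam]
  split_ifs with hgh
  · refine Submodule.smul_mem _ _ (subset_closedSpan ⟨h, a, ha, ?_⟩)
    rw [mul_one] at hgh
    rw [eq_inv_of_mul_eq_one_right hgh.symm]
  · rw [zero_smul]
    exact zero_mem _

theorem isClosed_deformation :
    IsClosed ((deformation α ω).toSubmodule : Set (L2 Γ (L2 Γ H) →L[ℂ] L2 Γ (L2 Γ H))) :=
  (NonUnitalStarSubalgebra.isClosed_topologicalClosure _).inter
    (isClosed_eq (map_continuous (diagonalCoaction Γ H))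
      (map_continuous (oneTensor (H := L2 Γ (L2 Γ H)) Γ)))

theorem mem_deformation_of_mem_spectral {g : Γ} {a : A} (ha : a ∈ α.spectral g) :
    leg12 (α.toHom a) * adTilde H ω.conj (lam ω.conj g⁻¹) ∈ deformation α ω := by
  refine ⟨NonUnitalStarSubalgebra.le_topologicalClosure _
    (NonUnitalStarAlgebra.subset_adjoin ℂ _
      ⟨a, _, lam_mem_twistedGroupAlgebra ω.conj g⁻¹, rfl⟩), ?_⟩
  rw [diagonalCoaction_generator α ω.conj ha, mul_inv_cancel,
    one_eq_tensorOp_lam _ (TwoCocycle.trivial Γ)]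

end Braided

/-! ### The unitary matching the two algebras -/

section Iso

variable {Γ H A : Type*} [Group Γ] [NormedAddCommGroup H] [InnerProductSpace ℂ H] [CompleteSpace H]
  [NonUnitalCStarAlgebra A] {π : A →⋆ₙₐ[ℂ] (H →L[ℂ] H)} {hπ : Function.Injective π}

/-- The diagonal unitary on `ℓ²(I) ⊗ H` with eigenvalues `c i`. -/
def phaseUnitary {I : Type*} (c : I → Circle) : L2 I H ≃ₗᵢ[ℂ] L2 I H where
  toFun f := ⟨fun i => (c i : ℂ) • f i, memℓp_two_iff.2 (by
    simpa only [norm_smul, Circle.norm_coe, one_mul] using f.summable_sq)⟩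
  invFun f := ⟨fun i => (((c i)⁻¹ : Circle) : ℂ) • f i, memℓp_two_iff.2 (by
    simpa only [norm_smul, Circle.norm_coe, one_mul] using f.summable_sq)⟩
  left_inv f := by
    ext i
    change (((c i)⁻¹ : Circle) : ℂ) • (c i : ℂ) • f i = f i
    rw [smul_smul, ← Circle.coe_mul, inv_mul_cancel, Circle.coe_one, one_smul]
  right_inv f := by
    ext i
    change (c i : ℂ) • (((c i)⁻¹ : Circle) : ℂ) • f i = f i
    rw [smul_smul, ← Circle.coe_mul, mul_inv_cancel, Circle.coe_one, one_smul]
  map_add' f g := by ext i; exact smul_add _ _ _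
  map_smul' z f := by ext i; exact smul_comm _ _ _
  norm_map' f := L2.norm_eq_of_tsum (tsum_congr fun i => by
    change ‖(c i : ℂ) • f i‖ ^ 2 = _
    rw [norm_smul, Circle.norm_coe, one_mul])

/-- The unitary `δ_m ⊗ δ_s ⊗ ξ ↦ δ_s ⊗ ξ ⊗ (λ^{(\bar ω)}_s)^* δ_m`. -/
def deformationUnitary (H : Type*) [NormedAddCommGroup H] [InnerProductSpace ℂ H]
    (ω : TwoCocycle Γ) : L2 Γ (L2 Γ H) ≃ₗᵢ[ℂ] L2 Γ (L2 Γ H) :=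
  ((permute (H := H)
    { toFun := fun p : Γ × Γ => (p.1 * p.2, p.1)
      invFun := fun p : Γ × Γ => (p.2, p.2⁻¹ * p.1)
      left_inv := fun p => by simp
      right_inv := fun p => by simp }).trans uncurry).trans
    ((phaseUnitary fun p : Γ × Γ => ω.toFun p.1 p.2).trans uncurry.symm)

theorem deformationUnitary_apply {H : Type*} [NormedAddCommGroup H] [InnerProductSpace ℂ H]
    (ω : TwoCocycle Γ) (f : L2 Γ (L2 Γ H)) (s t : Γ) :
    deformationUnitary H ω f s t = (ω.toFun s t : ℂ) • f (s * t) s := rfl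

theorem deformationUnitary_symm_apply {H : Type*} [NormedAddCommGroup H] [InnerProductSpace ℂ H]
    (ω : TwoCocycle Γ) (f : L2 Γ (L2 Γ H)) (m s : Γ) :
    (deformationUnitary H ω).symm f m s =
      (((ω.toFun s (s⁻¹ * m))⁻¹ : Circle) : ℂ) • f s (s⁻¹ * m) := rfl

/-- The amplification 1 ⊗ x leaves m unchanged, and U turns m into st. Moving s from r to hr with m
fixed therefore multiplies t by r⁻¹h⁻¹r, which is the translation made by (λ^{(ω̄)}_h)* conjugated
by λ^{(ω̄)}_{r⁻¹}. The phases agree by the cocycle identity. -/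
theorem conjAmp_deformationUnitary (ω : TwoCocycle Γ) (h : Γ) (b : H →L[ℂ] H) :
    conjAmp (deformationUnitary H ω) (tensorOp (lam ω h) b) =
      leg12 (tensorOp (lam (TwoCocycle.trivial Γ) h) b) *
        adTilde H ω.conj (star (lam ω.conj h)) := by
  ext f s t
  rw [conjAmp_apply, deformationUnitary_apply, oneTensor_apply, tensorOp_lam_apply,
    deformationUnitary_symm_apply]
  change _ = leg12 (tensorOp (lam (TwoCocycle.trivial Γ) h) b)
    (adTilde H ω.conj (star (lam ω.conj h)) f) s t
  rw [leg12_tensorOp_apply, oneTensor_apply, adTilde_apply, tensorOne_mul, tensorOne_mul]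
  -- Here r is the value of the first index on which the input is read.
  obtain ⟨r, rfl⟩ : ∃ r, s = h * r := ⟨h⁻¹ * s, by group⟩
  rw [inv_mul_cancel_left]
  change _ = b (tensorOne H (lam ω.conj r⁻¹) (tensorOne H (star (lam ω.conj h))
    (tensorOne H (star (lam ω.conj r⁻¹)) (f r))) t)
  have e : tensorOne H (lam ω.conj r⁻¹) = tensorOp (lam ω.conj r⁻¹) 1 := tensorOne_eq _
  rw [e, tensorOp_lam_apply, inv_inv, one_apply_eq_self, tensorOne_star_lam_apply,
    tensorOne_star_lam_apply, map_smul, map_smul, map_smul, map_smul]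
  have e2 : r⁻¹ * (h * (r * t)) = r⁻¹ * (h * r * t) := by group
  rw [smul_smul, smul_smul, smul_smul, smul_smul, e2]
  congr 1
  simp only [← Circle.coe_mul]
  congr 1
  change _ = (ω.toFun r⁻¹ (r * t))⁻¹ * (ω.toFun h (r * t))⁻¹⁻¹ *
    (ω.toFun r⁻¹ (h * (r * t)))⁻¹⁻¹
  -- `c1` trades ω(hr, t)ω(h, r) for ω(r, t)ω(h, rt); `c2` and `c3` express the phases with first
  -- argument r⁻¹ through ω(r⁻¹, r), which then cancels.
  have c1 := ω.cocycle h r t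
  have c2 := ω.cocycle r⁻¹ r t
  have c3 := ω.cocycle r⁻¹ r (r⁻¹ * (h * (r * t)))
  rw [inv_mul_cancel, ω.map_one_left, mul_one] at c2 c3
  rw [mul_inv_cancel_left] at c3
  rw [← e2, inv_inv, inv_inv]
  have c4 : ω.toFun r⁻¹ (h * (r * t)) =
      ω.toFun r⁻¹ r * (ω.toFun r (r⁻¹ * (h * (r * t))))⁻¹ := by
    rw [c3, mul_right_comm, mul_inv_cancel, one_mul]
  have c5 : (ω.toFun r⁻¹ (r * t))⁻¹ = ω.toFun r t * (ω.toFun r⁻¹ r)⁻¹ := by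
    rw [c2, mul_inv, mul_inv_cancel_left]
  have c6 : ω.toFun (h * r) t * ω.toFun h r = ω.toFun r t * ω.toFun h (r * t) := by
    rw [← c1, mul_comm]
  rw [c4, c5, c6]
  generalize ω.toFun r⁻¹ r = p, ω.toFun r t = x, ω.toFun h (r * t) = y,
    (ω.toFun r (r⁻¹ * (h * (r * t))))⁻¹ = z
  rw [show x * p⁻¹ * y * (p * z) = p⁻¹ * p * (x * y * z) by ac_rfl, inv_mul_cancel, one_mul]

variable (α : Coaction Γ π hπ) (ω : TwoCocycle Γ)

theorem conjAmp_deformationUnitary_generator {g : Γ} {a : A} (ha : a ∈ α.spectral g) :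
    conjAmp (deformationUnitary H ω) (tensorOp (lam ω g) (π a)) =
      (((ω.conj.toFun g g⁻¹)⁻¹ : Circle) : ℂ) •
        (leg12 (α.toHom a) * adTilde H ω.conj (lam ω.conj g⁻¹)) := by
  rw [conjAmp_deformationUnitary, ← show α.toHom a = _ from ha, lam_star, Circle.smul_def,
    ← adTildeHom_apply, map_smul, mul_smul_comm, adTildeHom_apply]

theorem conjAmp_deformationUnitary_mem {x : L2 Γ H →L[ℂ] L2 Γ H} (hx : x ∈ deformationAlt α ω) :
    conjAmp (deformationUnitary H ω) x ∈ deformation α ω := by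
  refine map_mem_of_mem_closedSpan (conjAmp (deformationUnitary H ω)).toAlgHom.toLinearMap
    (map_continuous (conjAmp (deformationUnitary H ω))) (isClosed_deformation α ω) ?_
    (mem_closedSpan_of_mem_deformationAlt α ω hx)
  rintro _ ⟨g, a, ha, rfl⟩
  change conjAmp (deformationUnitary H ω) _ ∈ deformation α ω
  rw [conjAmp_deformationUnitary_generator α ω ha]
  exact SMulMemClass.smul_mem _ (mem_deformation_of_mem_spectral α ω ha)

/-- Compressing 1 ⊗ x to the coordinate i recovers x; the index i serves to make `I` nonempty. -/
theorem conjAmp_injective {I H K : Type*} [NormedAddCommGroup H] [InnerProductSpace ℂ H]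
    [CompleteSpace H] [NormedAddCommGroup K] [InnerProductSpace ℂ K]
    [CompleteSpace K] (i : I) (U : L2 I H ≃ₗᵢ[ℂ] K) : Function.Injective (conjAmp U) := by
  intro x y hxy
  ext ξ
  have h := congrArg (fun F => U.symm F i) (DFunLike.congr_fun hxy (U (single i ξ)))
  simpa [conjAmp_apply] using h

/-- An injective *-homomorphism of C*-algebras is isometric, so the image of the closed span of the
generators of A'_ω is closed; it suffices to reach the generators of A_ω. -/
theorem exists_conjAmp_deformationUnitary_eq {T : L2 Γ (L2 Γ H) →L[ℂ] L2 Γ (L2 Γ H)}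
    (hT : T ∈ deformation α ω) :
    ∃ x ∈ deformationAlt α ω, conjAmp (deformationUnitary H ω) x = T := by
  have hiso := NonUnitalStarAlgHom.isometry (conjAmp (deformationUnitary H ω))
    (conjAmp_injective (1 : Γ) _)
  set p : Submodule ℂ (L2 Γ (L2 Γ H) →L[ℂ] L2 Γ (L2 Γ H)) :=
    (closedSpan (altGenerators α ω)).map
      (conjAmp (deformationUnitary H ω)).toAlgHom.toLinearMap with hp
  have hpc : IsClosed (p : Set (L2 Γ (L2 Γ H) →L[ℂ] L2 Γ (L2 Γ H))) := by
    rw [hp, Submodule.map_coe]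
    exact hiso.isClosedEmbedding.isClosedMap _ (isClosed_closedSpan _)
  have hTp : T ∈ p := by
    refine closedSpan_le hpc ?_ (mem_closedSpan_of_mem_deformation α ω hT)
    rintro _ ⟨g, a, ha, rfl⟩
    -- The scalar compensates for the phase relating (λ^{(ω̄)}_g)* to λ^{(ω̄)}_{g⁻¹}.
    refine ⟨((ω.conj.toFun g g⁻¹ : Circle) : ℂ) • tensorOp (lam ω g) (π a),
      Submodule.smul_mem _ _ (subset_closedSpan ⟨g, a, ha, rfl⟩), ?_⟩
    change conjAmp (deformationUnitary H ω) (_ • _) = _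
    rw [map_smul, conjAmp_deformationUnitary_generator α ω ha, smul_smul, ← Circle.coe_mul,
      mul_inv_cancel, Circle.coe_one, one_smul]
  obtain ⟨x, hx, rfl⟩ := hTp
  exact ⟨x, mem_deformationAlt_of_mem_closedSpan α ω hx, rfl⟩

end Iso

end CocycleDeformation

end

theorem mainTheorem4 {Γ : Type*} [Group Γ] {A : Type*} [NonUnitalCStarAlgebra A]
    {H : Type*} [NormedAddCommGroup H] [InnerProductSpace ℂ H] [CompleteSpace H]
    (π : A →⋆ₙₐ[ℂ] (H →L[ℂ] H)) (hπ : Function.Injective π)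
    (α : CocycleDeformation.Coaction Γ π hπ) (ω : CocycleDeformation.TwoCocycle Γ) :
    Nonempty (CocycleDeformation.deformation α ω ≃⋆ₐ[ℂ]
      CocycleDeformation.deformationAlt α ω) := by
  let θ := CocycleDeformation.conjAmp (CocycleDeformation.deformationUnitary H ω)
  let F : CocycleDeformation.deformationAlt α ω →⋆ₙₐ[ℂ] CocycleDeformation.deformation α ω :=
    { toFun := fun x => ⟨θ x.1, CocycleDeformation.conjAmp_deformationUnitary_mem α ω x.2⟩
      map_smul' := fun c x => Subtype.ext (map_smul θ c x.1)
      map_zero' := Subtype.ext (map_zero θ)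
      map_add' := fun x y => Subtype.ext (map_add θ x.1 y.1)
      map_mul' := fun x y => Subtype.ext (map_mul θ x.1 y.1)
      map_star' := fun x => Subtype.ext (map_star θ x.1) }
  -- The spatial homomorphism runs from A'_ω to A_ω, hence the inverse.
  refine ⟨(StarAlgEquiv.ofBijective F ⟨fun x y hxy => ?_, fun T => ?_⟩).symm⟩
  · exact Subtype.ext (CocycleDeformation.conjAmp_injective (1 : Γ) _ (congrArg Subtype.val hxy))
  · obtain ⟨x, hx, hxT⟩ := CocycleDeformation.exists_conjAmp_deformationUnitary_eq α ω T.2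
    exact ⟨⟨x, hx⟩, Subtype.ext hxT⟩
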